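/- Terminology. An interval space is a topological space whose topology is the order topology of some linear ordering of its points. A space is scattered if it is compact Hausdorff and every nonempty subset of it has an isolated point in its relative topology. A space is a CO space if every closed subset of it is homeomorphic to some clopen subset of it. For infinite cardinals $\kappa,\lambda,\mu$ (identified with initial ordinals), $X_{\kappa,\lambda,\mu}$ is the quotient of the disjoint union of the interval spaces $\kappa+1$, $\lambda+1$, $\mu+1$ obtained by identifying the three points $\kappa$, $\lambda$ and $\mu$ with one another. The triple $(\kappa,\lambda,\mu)$ is legal if $\kappa,\lambda,\mu$ are infinite regular cardinals and $\lambda,\mu>\aleph_0$. $X_{\aleph_1}$ is the one-point compactification of a discrete space of cardinality $\aleph_1$. For a space $F$ let $D_0(F)=F$, let $D_{\alpha+1}(F)$ be $D_\alpha(F)$ without its isolated points, and let $D_\delta(F)=\bigcap_{\alpha<\delta}D_\alpha(F)$ for limit $\delta$. For compact Hausdorff $F$ the rank $\mathrm{rk}(F)$ is the first $\alpha$ such that $D_\alpha(F)$ is finite or has no isolated points; if $D_{\mathrm{rk}(F)}(F)$ is a singleton $\{e\}$, its element $e=e^F$ is called the top point of $F$. Proposition 5.1. Let $X$ be a scattered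 space which is a continuous image of a compact interval space, and assume that $X$ is a CO space. (a) If $(\kappa,\lambda,\mu)$ is a legal triple, then $X_{\kappa,\lambda,\mu}$ is not embeddable in $X$, that is, no subspace of $X$ is homeomorphic to $X_{\kappa,\lambda,\mu}$. (b) The set $\{e^F : F\subseteq X \text{ and } F\cong X_{\aleph_1}\}$ is finite. -/

import Mathlib

open Topology

universe u v w

namespace COSpaces

/-- A topological space is an interval space if its topology is the order topology of some
linear ordering of its points. -/
def IsIntervalSpace (Y : Type u) [TopologicalSpace Y] : Prop :=
  ∃ _ : LinearOrder Y, OrderTopology Y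

/-- `X` is a continuous image of a compact interval space. -/
def IsContinuousImageOfCompactIntervalSpace (X : Type u) [TopologicalSpace X] : Prop :=
  ∃ (Y : Type v) (_ : TopologicalSpace Y), CompactSpace Y ∧ IsIntervalSpace Y ∧
    ∃ f : Y → X, Continuous f ∧ Function.Surjective f

/-- A scattered space is a compact Hausdorff space in which every nonempty subset has an isolated
point in its relative topology. -/
structure IsScatteredSpace (X : Type u) [TopologicalSpace X] : Prop where
  compact : CompactSpace X
  hausdorff : T2Space X
  exists_isolated : ∀ A : Set X, A.Nonempty → ∃ a ∈ A, ∃ U : Set X, IsOpen U ∧ U ∩ A = {a}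

/-- A CO space: every closed subset is homeomorphic to some clopen subset. -/
def IsCOSpace (X : Type u) [TopologicalSpace X] : Prop :=
  ∀ F : Set X, IsClosed F → ∃ U : Set X, IsClopen U ∧ Nonempty (F ≃ₜ U)

/-- The interval space `κ + 1`, i.e. the space of all ordinals `≤ κ` (where the cardinal `κ` is
identified with its initial ordinal). -/
abbrev CardSucc (κ : Cardinal.{w}) : Type (w + 1) := Set.Iic κ.ord

/-- The last point `κ` of the space `κ + 1`. -/
noncomputable def CardSucc.last (κ : Cardinal.{w}) : CardSucc κ := ⟨κ.ord, Set.mem_Iic.2 le_rfl⟩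

/-- The three last points in the disjoint union of `κ + 1`, `lam + 1` and `mu + 1`. -/
def lastPoints (κ lam mu : Cardinal.{w}) : Set (CardSucc κ ⊕ CardSucc lam ⊕ CardSucc mu) :=
  {Sum.inl (CardSucc.last κ), Sum.inr (Sum.inl (CardSucc.last lam)),
    Sum.inr (Sum.inr (CardSucc.last mu))}

/-- The equivalence relation that identifies the three last points with each other and nothing
else. -/
def tripleSetoid (κ lam mu : Cardinal.{w}) :
    Setoid (CardSucc κ ⊕ CardSucc lam ⊕ CardSucc mu) where
  r x y := x = y ∨ (x ∈ lastPoints κ lam mu ∧ y ∈ lastPoints κ lam mu)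
  iseqv :=
    { refl := fun _ => Or.inl rfl
      symm := by
        rintro x y (h | ⟨hx, hy⟩)
        · exact Or.inl h.symm
        · exact Or.inr ⟨hy, hx⟩
      trans := by
        rintro x y z (rfl | ⟨hx, hy⟩) (rfl | ⟨hy', hz⟩)
        · exact Or.inl rfl
        · exact Or.inr ⟨hy', hz⟩
        · exact Or.inr ⟨hx, hy⟩
        · exact Or.inr ⟨hx, hz⟩ }

/-- The space `X_{κ,lam,mu}`: the quotient (with the quotient topology) of the disjoint union of
the interval spaces `κ + 1`, `lam + 1` and `mu + 1` in which the points `κ`, `lam` and `mu` are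
identified. -/
abbrev TripleSpace (κ lam mu : Cardinal.{w}) : Type (w + 1) := Quotient (tripleSetoid κ lam mu)

/-- `(κ, lam, mu)` is a legal triple. -/
def IsLegalTriple (κ lam mu : Cardinal.{w}) : Prop :=
  κ.IsRegular ∧ lam.IsRegular ∧ mu.IsRegular ∧ Cardinal.aleph0 < lam ∧ Cardinal.aleph0 < mu

/-- A set of cardinality `κ`, to be given the discrete topology. -/
def DiscreteOfCard (κ : Cardinal.{w}) : Type w := Quotient.out κ

instance (κ : Cardinal.{w}) : TopologicalSpace (DiscreteOfCard κ) := ⊥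

/-- The space `X_κ`: the one-point compactification of a discrete space of cardinality `κ`. -/
abbrev OnePointDiscrete (κ : Cardinal.{w}) : Type w := OnePoint (DiscreteOfCard κ)

/-- The rank of a subspace `F`: the first ordinal `α` such that the `α`-th Cantor-Bendixson
derivative of `F` is finite or has no isolated points in its relative topology. (The iterated
relative derived set of `F` in the ambient space is the iterated derivative of the subspace `F`:
one step removes from a set its relatively isolated points.) -/
noncomputable def rank {X : Type u} [TopologicalSpace X] (F : Set X) : Ordinal.{u} :=
  sInf {α : Ordinal.{u} | (CantorBendixson.iteratedDerivedSet F α).Finite ∨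
    Preperfect (CantorBendixson.iteratedDerivedSet F α)}

/-- `e` is the top point of the subspace `F`: the derivative of `F` whose index is the rank of `F`
is the singleton `{e}`. -/
def IsTopPoint {X : Type u} [TopologicalSpace X] (F : Set X) (e : X) : Prop :=
  CantorBendixson.iteratedDerivedSet F (rank F) = {e}

end COSpaces

namespace COSpaces

/-! ### Scattered spaces are zero-dimensional -/

section Scattered

variable {X : Type u} [TopologicalSpace X]

/-! The interval space enters through two facts only. First, interval spaces are monotonically
normal, and closed maps preserve this, so `X` is monotonically normal. As `X` is also
zero-dimensional, a relatively discrete set `I` expands to disjoint clopen sets `W a` such that, for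
every choice of closed `T a` with `a ∈ T a ⊆ W a`, the set `closure I ∪ ⋃ T a` is closed and meets
`W a` exactly in `T a` (`IsScatteredSpace.exists_expansion`). Second, a point of `closure A \ A` is
always a limit of two disjoint parts of `A`.

The CO property turns each such closed set into a clopen subset of `X`, so points with prescribed
local behaviour in the closed set become points with that behaviour in `X`.

Let `P`, `Q` be exclusive local properties, with `P`- and `Q`-points isolated from one another, such
that a `P`-point becomes a `Q`-point in a suitable closed subspace. Then `X` has finitely many
`P`-points (`IsShrinkablePair.finite`). Otherwise let `E` be a finite nonempty Cantor-Bendixson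
derivative of the closure of the set `I` of `P`-points. Keeping all the `W a` gives a closed set
without `Q`-points. Its clopen copy must contain `E`, because the copied derivative lies in the
finite set `E` and is at least as large; so some neighbourhood of `E` is free of `Q`-points. Now
turn into `Q`-points a part of `I` that accumulates at some `e ∈ E`, chosen so that the rest of `I`
still has all of `E` in its derivative. The new clopen copy again sends `E` into `E`, and so makes
`Q`-points accumulate at a point of `E`: a contradiction.

For the top points of copies of `X_{ℵ₁}`, `P` and `Q` say that the point is the centre of an
uncountable, respectively countable, fan of isolated points. Infinitely many top points would yield,
by one more expansion, infinitely many `P`-points of `X`.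

For triples, `P` and `Q` say that at least two branches, respectively one branch, leave the point.
Once `P`-points are finite in number, replacing all of them by points with exactly two branches and
embedding the result permutes them, so every `P`-point has exactly two branches. The vertex of a
clopen copy of `X_{κ,λ,μ}` is a `P`-point with three branches. -/

theorem IsScatteredSpace.totallyDisconnected (h : IsScatteredSpace X) :
    TotallyDisconnectedSpace X := by
  have := h.hausdorff
  refine ⟨fun t _ ht => ?_⟩
  by_contra hne
  rw [Set.not_subsingleton_iff] at hne
  obtain ⟨a, ha, U, hU, hUt⟩ := h.exists_isolated t hne.nonempty
  have hpre := ht.preperfect_of_nontrivial hne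
  rw [preperfect_iff_nhds] at hpre
  have haU : a ∈ U := (hUt.symm ▸ Set.mem_singleton a : a ∈ U ∩ t).1
  obtain ⟨y, hy, hya⟩ := hpre a ha U (hU.mem_nhds haU)
  rw [hUt] at hy
  exact hya hy

theorem IsScatteredSpace.exists_isClopen (h : IsScatteredSpace X) {x : X} {O : Set X}
    (hO : IsOpen O) (hx : x ∈ O) : ∃ W : Set X, IsClopen W ∧ x ∈ W ∧ W ⊆ O := by
  have := h.hausdorff
  have := h.compact
  have := h.totallyDisconnected
  exact compact_exists_isClopen_in_isOpen hO hx

end Scattered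

/-- A monotone normality operator: it shrinks the neighbourhood `U` of `x` to `H x U` in such a
way that `H x U` and `H y V` meet only if `x ∈ V` or `y ∈ U`. -/
structure IsMonotoneNormalityOperator {X : Type u} [TopologicalSpace X]
    (H : X → Set X → Set X) : Prop where
  isOpen : ∀ x U, IsOpen U → x ∈ U → IsOpen (H x U)
  mem : ∀ x U, IsOpen U → x ∈ U → x ∈ H x U
  subset : ∀ x U, IsOpen U → x ∈ U → H x U ⊆ U
  mem_or_mem : ∀ x U y V, IsOpen U → x ∈ U → IsOpen V → y ∈ V → (H x U ∩ H y V).Nonempty →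
    x ∈ V ∨ y ∈ U

/-! ### Monotone normality of interval spaces and their images -/

section LinearOrder

variable {Y : Type v} [TopologicalSpace Y] [LinearOrder Y] [OrderTopology Y]

/-- Fix a well-ordering `r` of the points. On each side, `H x U` stops at the `r`-least point `p`
(right) or `q` (left) that is joined to `x` inside `U`. If the intervals of `x < y` overlap while `x
∉ V` and `y ∉ U`, then `x < q y V < p x U < y`, so each of these two points competed in the choice
of the other, which contradicts `r`-minimality. -/
theorem exists_monotoneNormalityOperator_of_linearOrder :
    ∃ H : Y → Set Y → Set Y, IsMonotoneNormalityOperator H := by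
  classical
  let r : Y → Y → Prop := WellOrderingRel
  have wf : WellFounded r := IsWellFounded.wf
  have hleast : ∀ S : Set Y, S.Nonempty → ∃ p ∈ S, ∀ q ∈ S, ¬ r q p := fun S hS =>
    wf.has_min S hS
  let R : Y → Set Y → Set Y := fun x U => {w | x < w ∧ Set.Icc x w ⊆ U}
  let L : Y → Set Y → Set Y := fun x U => {w | w < x ∧ Set.Icc w x ⊆ U}
  have hp : ∀ x U, ∃ p : Y, (R x U).Nonempty → p ∈ R x U ∧ ∀ q ∈ R x U, ¬ r q p := by
    intro x U
    by_cases h : (R x U).Nonempty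
    · obtain ⟨p, hp⟩ := hleast _ h
      exact ⟨p, fun _ => hp⟩
    · exact ⟨x, fun h' => (h h').elim⟩
  have hq : ∀ x U, ∃ p : Y, (L x U).Nonempty → p ∈ L x U ∧ ∀ q ∈ L x U, ¬ r q p := by
    intro x U
    by_cases h : (L x U).Nonempty
    · obtain ⟨p, hp⟩ := hleast _ h
      exact ⟨p, fun _ => hp⟩
    · exact ⟨x, fun h' => (h h').elim⟩
  choose p hp using hp
  choose q hq using hq
  let H : Y → Set Y → Set Y := fun x U =>
    {z | (x < z → (R x U).Nonempty ∧ z < p x U) ∧ (z < x → (L x U).Nonempty ∧ q x U < z)}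
  have hsub : ∀ x U, x ∈ U → H x U ⊆ U := by
    intro x U hx z hz
    rcases lt_trichotomy x z with h | rfl | h
    · obtain ⟨h1, h2⟩ := hz.1 h
      exact (hp x U h1).1.2 ⟨h.le, h2.le⟩
    · exact hx
    · obtain ⟨h1, h2⟩ := hz.2 h
      exact (hq x U h1).1.2 ⟨h2.le, h.le⟩
  have key : ∀ x U y V, x ∈ U → y ∈ V → x < y → (H x U ∩ H y V).Nonempty →
      x ∈ V ∨ y ∈ U := by
    rintro x U y V hx hy hxy ⟨z, hzU, hzV⟩
    by_contra! hcon
    obtain ⟨hxV, hyU⟩ := hcon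
    have hxz : x < z := by
      by_contra! h
      have h1 := hzV.2 (h.trans_lt hxy)
      exact hxV ((hq y V h1.1).1.2 ⟨h1.2.le.trans h, hxy.le⟩)
    have hzy : z < y := by
      by_contra! h
      have h1 := hzU.1 (hxy.trans_le h)
      exact hyU ((hp x U h1.1).1.2 ⟨hxy.le, h.trans h1.2.le⟩)
    obtain ⟨hR, hzp⟩ := hzU.1 hxz
    obtain ⟨hL, hqz⟩ := hzV.2 hzy
    obtain ⟨⟨hxp, hpU⟩, hpmin⟩ := hp x U hR
    obtain ⟨⟨hqy, hqV⟩, hqmin⟩ := hq y V hL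
    have hpy : p x U < y := by
      by_contra! h
      exact hyU (hpU ⟨hxy.le, h⟩)
    have hxq : x < q y V := by
      by_contra! h
      exact hxV (hqV ⟨h, hxy.le⟩)
    have hqp : q y V < p x U := hqz.trans hzp
    have h1 : ¬ r (q y V) (p x U) := hpmin _ ⟨hxq, (Set.Icc_subset_Icc_right hqp.le).trans hpU⟩
    have h2 : ¬ r (p x U) (q y V) := hqmin _ ⟨hpy, (Set.Icc_subset_Icc_left hqp.le).trans hqV⟩
    rcases trichotomous_of r (q y V) (p x U) with h | h | h
    · exact h1 h
    · exact hqp.ne h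
    · exact h2 h
  refine ⟨H, ?_, ?_, ?_, ?_⟩
  · intro x U hU hx
    have hH : H x U = ({z | x < z → (R x U).Nonempty ∧ z < p x U}) ∩
      {z | z < x → (L x U).Nonempty ∧ q x U < z} := rfl
    rw [hH]
    refine IsOpen.inter ?_ ?_
    · by_cases h : (R x U).Nonempty
      · convert isOpen_Iio (a := p x U) using 1
        ext z
        simp only [h, true_and, Set.mem_ofPred_eq, Set.mem_Iio]
        refine ⟨fun hz => ?_, fun hz _ => hz⟩
        by_cases hzx : x < z
        · exact hz hzx
        · exact (not_lt.1 hzx).trans_lt (hp x U h).1.1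
      · have : {z | x < z → (R x U).Nonempty ∧ z < p x U} = Set.Iic x := by
          ext z; simp [h]
        rw [this, isOpen_iff_mem_nhds]
        intro z hz
        -- If `R x U` is empty, `x` is either the maximum or has an immediate successor `w`, so `Iic
        -- x` is open.
        by_cases hmax : ∃ w, x < w
        · obtain ⟨w, hxw, hw⟩ := exists_Ico_subset_of_mem_nhds (hU.mem_nhds hx) hmax
          have hempty : ∀ c, x < c → w ≤ c := by
            intro c hc
            by_contra! hcw
            exact h ⟨c, hc, fun d hd => hw ⟨hd.1, hd.2.trans_lt hcw⟩⟩
          refine Filter.mem_of_superset (Iio_mem_nhds (lt_of_le_of_lt hz hxw)) fun c hc => ?_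
          by_contra hcx
          exact absurd (hempty c (not_le.1 hcx)) (not_le.2 hc)
        · push Not at hmax
          exact Filter.univ_mem' hmax
    · by_cases h : (L x U).Nonempty
      · convert isOpen_Ioi (a := q x U) using 1
        ext z
        simp only [h, true_and, Set.mem_ofPred_eq, Set.mem_Ioi]
        refine ⟨fun hz => ?_, fun hz _ => hz⟩
        by_cases hzx : z < x
        · exact hz hzx
        · exact (hq x U h).1.1.trans_le (not_lt.1 hzx)
      · have : {z | z < x → (L x U).Nonempty ∧ q x U < z} = Set.Ici x := by
          ext z; simp [h]
        rw [this, isOpen_iff_mem_nhds]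
        intro z hz
        by_cases hmin : ∃ w, w < x
        · obtain ⟨w, hxw, hw⟩ := exists_Ioc_subset_of_mem_nhds (hU.mem_nhds hx) hmin
          have hempty : ∀ c, c < x → c ≤ w := by
            intro c hc
            by_contra! hcw
            exact h ⟨c, hc, fun d hd => hw ⟨hcw.trans_le hd.1, hd.2⟩⟩
          refine Filter.mem_of_superset (Ioi_mem_nhds (lt_of_lt_of_le hxw hz)) fun c hc => ?_
          by_contra hcx
          exact absurd (hempty c (not_le.1 hcx)) (not_le.2 hc)
        · push Not at hmin
          exact Filter.univ_mem' hmin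
  · intro x U _ _
    exact ⟨fun h => (lt_irrefl _ h).elim, fun h => (lt_irrefl _ h).elim⟩
  · exact fun x U _ hx => hsub x U hx
  · intro x U y V _ hx _ hy hne
    rcases lt_trichotomy x y with h | rfl | h
    · exact key x U y V hx hy h hne
    · exact Or.inl hy
    · exact (key y V x U hy hx h (Set.inter_comm _ _ ▸ hne)).symm

end LinearOrder

/-- A point `z` belongs to the new neighbourhood of `x` when its whole fibre is covered by the old
neighbourhoods of the points in the fibre of `x`. This set is open because its complement is the
image of a closed set. Any `y` over a common point of two new neighbourhoods lies in two old ones.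
-/
theorem IsMonotoneNormalityOperator.exists_of_isClosedMap {X : Type u} {Y : Type v}
    [TopologicalSpace X] [TopologicalSpace Y] {H : Y → Set Y → Set Y}
    (hH : IsMonotoneNormalityOperator H) {f : Y → X} (hf : Continuous f) (hcl : IsClosedMap f)
    (hsurj : Function.Surjective f) :
    ∃ G : X → Set X → Set X, IsMonotoneNormalityOperator G := by
  refine ⟨fun x U => {z | ∀ y, f y = z → ∃ t, f t = x ∧ y ∈ H t (f ⁻¹' U)}, ?_, ?_, ?_, ?_⟩
  · intro x U hU hx
    have : {z | ∀ y, f y = z → ∃ t, f t = x ∧ y ∈ H t (f ⁻¹' U)} =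
        (f '' (⋃ t ∈ f ⁻¹' {x}, H t (f ⁻¹' U))ᶜ)ᶜ := by
      ext z
      simp only [Set.mem_ofPred_eq, Set.mem_compl_iff, Set.mem_image, Set.mem_iUnion,
        Set.mem_preimage, Set.mem_singleton_iff, not_exists, not_and]
      constructor
      · rintro h y hy rfl
        obtain ⟨t, ht, hyt⟩ := h y rfl
        exact hy t ht hyt
      · rintro h y rfl
        by_contra! hcon
        exact h y hcon rfl
    rw [this]
    refine (hcl _ (IsOpen.isClosed_compl ?_)).isOpen_compl
    refine isOpen_biUnion fun t ht => hH.isOpen _ _ (hU.preimage hf) ?_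
    change f t ∈ U
    rw [show f t = x from ht]; exact hx
  · rintro x U hU hx y rfl
    exact ⟨y, rfl, hH.mem _ _ (hU.preimage hf) hx⟩
  · intro x U hU hx z hz
    obtain ⟨y, rfl⟩ := hsurj z
    obtain ⟨t, rfl, hy⟩ := hz y rfl
    exact hH.subset t _ (hU.preimage hf) hx hy
  · rintro x U x' V hU hx hV hx' ⟨z, hz, hz'⟩
    obtain ⟨y, rfl⟩ := hsurj z
    obtain ⟨t, rfl, hy⟩ := hz y rfl
    obtain ⟨t', rfl, hy'⟩ := hz' y rfl
    exact hH.mem_or_mem t _ t' _ (hU.preimage hf) hx (hV.preimage hf) hx' ⟨y, hy, hy'⟩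

theorem IsContinuousImageOfCompactIntervalSpace.exists_monotoneNormalityOperator
    {X : Type u} [TopologicalSpace X] [T2Space X]
    (h : IsContinuousImageOfCompactIntervalSpace.{u, v} X) :
    ∃ G : X → Set X → Set X, IsMonotoneNormalityOperator G := by
  obtain ⟨Y, _, _, ⟨_, _⟩, f, hf, hsurj⟩ := h
  obtain ⟨H, hH⟩ := exists_monotoneNormalityOperator_of_linearOrder (Y := Y)
  exact hH.exists_of_isClosedMap hf hf.isClosedMap hsurj

/-- The points of a relatively discrete set in a scattered monotonically normal space can be
expanded to disjoint clopen sets whose only accumulation points are those of the set itself. -/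
theorem IsScatteredSpace.exists_expansion {X : Type u} [TopologicalSpace X]
    (h : IsScatteredSpace X) {H : X → Set X → Set X} (hH : IsMonotoneNormalityOperator H)
    {I : Set X} {O : X → Set X} (hO : ∀ a ∈ I, IsOpen (O a)) (haO : ∀ a ∈ I, O a ∩ I = {a}) :
    ∃ W : X → Set X, (∀ a ∈ I, IsClopen (W a) ∧ a ∈ W a ∧ W a ⊆ O a) ∧
      (∀ T : X → Set X, (∀ a ∈ I, IsClosed (T a) ∧ a ∈ T a ∧ T a ⊆ W a) →
        IsClosed (closure I ∪ ⋃ a ∈ I, T a) ∧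
        ∀ a ∈ I, (closure I ∪ ⋃ b ∈ I, T b) ∩ W a = T a) := by
  have hmemO : ∀ a ∈ I, a ∈ O a := fun a ha =>
    (by rw [haO a ha]; exact Set.mem_singleton a : a ∈ O a ∩ I).1
  have step : ∀ N : X → Set X, (∀ a ∈ I, IsOpen (N a) ∧ a ∈ N a) → ∃ W : X → Set X,
      ∀ a ∈ I, IsClopen (W a) ∧ a ∈ W a ∧ W a ⊆ H a (N a) := by
    intro N hN
    have : ∀ a, ∃ W : Set X, a ∈ I → IsClopen W ∧ a ∈ W ∧ W ⊆ H a (N a) := by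
      intro a
      by_cases ha : a ∈ I
      · obtain ⟨W, hW⟩ := h.exists_isClopen (hH.isOpen a _ (hN a ha).1 (hN a ha).2)
          (hH.mem a _ (hN a ha).1 (hN a ha).2)
        exact ⟨W, fun _ => hW⟩
      · exact ⟨∅, fun h => (ha h).elim⟩
    choose W hW using this
    exact ⟨W, hW⟩
  -- The operator is applied twice: the first shrinking makes the `N a` disjoint, the second, to `W
  -- a`, controls accumulation outside `closure I`.
  obtain ⟨N, hN⟩ := step O fun a ha => ⟨hO a ha, hmemO a ha⟩
  have hNO : ∀ a ∈ I, N a ⊆ O a := fun a ha =>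
    (hN a ha).2.2.trans (hH.subset a _ (hO a ha) (hmemO a ha))
  have hNdisj : ∀ a ∈ I, ∀ b ∈ I, (N a ∩ N b).Nonempty → a = b := by
    rintro a ha b hb ⟨z, hza, hzb⟩
    rcases hH.mem_or_mem a _ b _ (hO a ha) (hmemO a ha) (hO b hb) (hmemO b hb)
      ⟨z, (hN a ha).2.2 hza, (hN b hb).2.2 hzb⟩ with h1 | h1
    · exact (haO b hb ▸ ⟨h1, ha⟩ : a ∈ ({b} : Set X))
    · exact (haO a ha ▸ ⟨h1, hb⟩ : b ∈ ({a} : Set X)).symm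
  obtain ⟨W, hW⟩ := step N fun a ha => ⟨(hN a ha).1.isOpen, (hN a ha).2.1⟩
  have hWN : ∀ a ∈ I, W a ⊆ N a := fun a ha =>
    (hW a ha).2.2.trans (hH.subset a _ (hN a ha).1.isOpen (hN a ha).2.1)
  have hWI : ∀ a ∈ I, W a ∩ closure I ⊆ {a} := by
    intro a ha z hz
    by_contra hza
    have := h.hausdorff
    have hopen : IsOpen (W a \ {a}) := (hW a ha).1.isOpen.sdiff isClosed_singleton
    obtain ⟨b, hb, hbI⟩ := mem_closure_iff.1 hz.2 _ hopen ⟨hz.1, hza⟩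
    exact hb.2 (haO a ha ▸ ⟨hNO a ha (hWN a ha hb.1), hbI⟩ : b ∈ ({a} : Set X))
  refine ⟨W, fun a ha => ⟨(hW a ha).1, (hW a ha).2.1, (hWN a ha).trans (hNO a ha)⟩, ?_⟩
  intro T hT
  have hinter : ∀ a ∈ I, (closure I ∪ ⋃ b ∈ I, T b) ∩ W a = T a := by
    intro a ha
    ext z
    constructor
    · rintro ⟨hz | hz, hza⟩
      · have : z = a := hWI a ha ⟨hza, hz⟩
        exact this ▸ (hT a ha).2.1
      · simp only [Set.mem_iUnion] at hz
        obtain ⟨b, hb, hzb⟩ := hz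
        have : a = b := hNdisj a ha b hb ⟨z, hWN a ha hza, hWN b hb ((hT b hb).2.2 hzb)⟩
        exact this ▸ hzb
    · intro hz
      exact ⟨Or.inr (Set.mem_biUnion ha hz), (hT a ha).2.2 hz⟩
  refine ⟨?_, hinter⟩
  rw [← isOpen_compl_iff, isOpen_iff_mem_nhds]
  intro z hz
  by_cases hzW : ∃ a ∈ I, z ∈ W a
  · obtain ⟨a, ha, hza⟩ := hzW
    have hzT : z ∉ T a := fun h => hz (Or.inr (Set.mem_biUnion ha h))
    refine Filter.mem_of_superset
      (((hW a ha).1.isOpen.sdiff (hT a ha).1).mem_nhds ⟨hza, hzT⟩) ?_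
    intro y hy hyF
    exact hy.2 (hinter a ha ▸ ⟨hyF, hy.1⟩)
  · push Not at hzW
    have hzI : z ∉ closure I := fun h => hz (Or.inl h)
    -- With `U` the complement of `closure I ∪ D`, the set `H z U` can meet `W b` only if `z ∈ N b`,
    -- since `b ∈ U` is impossible. By disjointness at most one `b` qualifies, and `D` absorbs its
    -- `W b`.
    have main : ∀ D : Set X, IsClopen D → z ∉ D → (∀ b ∈ I, z ∈ N b → W b ⊆ D) →
        (closure I ∪ ⋃ b ∈ I, T b)ᶜ ∈ 𝓝 z := by
      intro D hD hzD hDN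
      have hUo : IsOpen ((closure I)ᶜ ∩ Dᶜ) :=
        isClosed_closure.isOpen_compl.inter hD.isClosed.isOpen_compl
      have hzU : z ∈ (closure I)ᶜ ∩ Dᶜ := ⟨hzI, hzD⟩
      refine Filter.mem_of_superset ((hH.isOpen z _ hUo hzU).mem_nhds (hH.mem z _ hUo hzU)) ?_
      intro y hy hyF
      have hyU := hH.subset z _ hUo hzU hy
      rcases hyF with hyF | hyF
      · exact hyU.1 hyF
      · simp only [Set.mem_iUnion] at hyF
        obtain ⟨b, hb, hyb⟩ := hyF
        have hyW := (hT b hb).2.2 hyb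
        rcases hH.mem_or_mem z _ b _ hUo hzU (hN b hb).1.isOpen (hN b hb).2.1
          ⟨y, hy, (hW b hb).2.2 hyW⟩ with h1 | h1
        · exact hyU.2 (hDN b hb h1 hyW)
        · exact h1.1 (subset_closure hb)
    by_cases hzN : ∃ a ∈ I, z ∈ N a
    · obtain ⟨a, ha, hza⟩ := hzN
      refine main (W a) (hW a ha).1 (hzW a ha) fun b hb hzb => ?_
      rw [hNdisj a ha b hb ⟨z, hza, hzb⟩]
    · push Not at hzN
      exact main ∅ isClopen_empty (Set.notMem_empty z) fun b hb hzb => (hzN b hb hzb).elim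

/-! ### Cantor-Bendixson derivatives -/

section Derivative

open CantorBendixson

variable {X Z : Type u} [TopologicalSpace X] [TopologicalSpace Z]

theorem _root_.Topology.IsEmbedding.accPt_image_iff {X : Type u} {Z : Type v}
    [TopologicalSpace X] [TopologicalSpace Z] {i : Z → X} (hi : IsEmbedding i) {s : Set Z}
    {z : Z} : AccPt (i z) (Filter.principal (i '' s)) ↔ AccPt z (Filter.principal s) := by
  constructor
  · intro h
    rw [accPt_iff_nhds] at h ⊢
    intro U hU
    rw [hi.nhds_eq_comap, Filter.mem_comap] at hU
    obtain ⟨V, hV, hVU⟩ := hU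
    obtain ⟨_, ⟨hyV, y, hys, rfl⟩, hne⟩ := h V hV
    exact ⟨y, ⟨hVU hyV, hys⟩, fun h => hne (h ▸ rfl)⟩
  · intro h
    have := h.map hi.continuous.continuousAt hi.injective
    rwa [Filter.map_principal] at this

theorem image_iteratedDerivedSet {i : Z → X} (hi : IsEmbedding i) (s : Set Z) (a : Ordinal) :
    i '' iteratedDerivedSet s a = iteratedDerivedSet (i '' s) a := by
  induction a using Ordinal.limitRecOn with
  | zero => simp
  | add_one a ih =>
    rw [iteratedDerivedSet_succ, iteratedDerivedSet_succ, ← ih]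
    ext x
    simp only [relDerivedSet_apply, Set.mem_image, Set.mem_inter_iff, mem_derivedSet]
    constructor
    · rintro ⟨z, ⟨hz, hz'⟩, rfl⟩
      exact ⟨hi.accPt_image_iff.2 hz, z, hz', rfl⟩
    · rintro ⟨hz, z, hz', rfl⟩
      exact ⟨z, ⟨hi.accPt_image_iff.1 hz, hz'⟩, rfl⟩
  | limit a ha ih =>
    have : Nonempty (Set.Iio a) := ⟨⟨0, ha.bot_lt⟩⟩
    rw [iteratedDerivedSet_limit ha, iteratedDerivedSet_limit ha,
      hi.injective.injOn.image_iInter_eq]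
    exact Set.iInter_congr fun b => ih b b.2

theorem iteratedDerivedSet_union {s t : Set X} (hs : IsClosed s) (ht : IsClosed t) (a : Ordinal) :
    iteratedDerivedSet (s ∪ t) a = iteratedDerivedSet s a ∪ iteratedDerivedSet t a := by
  induction a using Ordinal.limitRecOn with
  | zero => simp
  | add_one a ih =>
    rw [iteratedDerivedSet_succ, iteratedDerivedSet_succ, iteratedDerivedSet_succ, ih,
      (isClosed_iteratedDerivedSet hs a).relDerivedSet_eq,
      (isClosed_iteratedDerivedSet ht a).relDerivedSet_eq,
      ((isClosed_iteratedDerivedSet hs a).union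
        (isClosed_iteratedDerivedSet ht a)).relDerivedSet_eq, derivedSet_union]
  | limit a ha ih =>
    refine Set.Subset.antisymm ?_ (Set.union_subset
      (iteratedDerivedSet_mono Set.subset_union_left a)
      (iteratedDerivedSet_mono Set.subset_union_right a))
    intro x hx
    by_contra hcon
    simp only [iteratedDerivedSet_limit ha, Set.mem_union, Set.mem_iInter, not_or, not_forall]
      at hx hcon
    obtain ⟨⟨b, hb⟩, ⟨c, hc⟩⟩ := hcon
    have h := hx (max b c)
    rw [ih _ (max b c).2] at h
    rcases h with h | h
    · exact hb (iteratedDerivedSet_antitone s (Subtype.coe_le_coe.2 (le_max_left b c)) h)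
    · exact hc (iteratedDerivedSet_antitone t (Subtype.coe_le_coe.2 (le_max_right b c)) h)

theorem iteratedDerivedSet_subset_derivedSet (s : Set X) {a : Ordinal} (ha : a ≠ 0) :
    iteratedDerivedSet s a ⊆ derivedSet s := by
  have h1 : (0 : Ordinal) + 1 ≤ a := by
    rw [zero_add]; exact Order.one_le_iff_pos.2 (pos_iff_ne_zero.2 ha)
  refine (iteratedDerivedSet_antitone s h1).trans ?_
  rw [iteratedDerivedSet_succ, iteratedDerivedSet_zero]
  exact fun x hx => hx.1

/-- Scatteredness empties the perfect kernel, so there is a least index with finite derivative. All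
earlier derivatives are infinite, and compactness makes this one nonempty, both at successors and at
limits. -/
theorem IsScatteredSpace.exists_finite_nonempty_iteratedDerivedSet (h : IsScatteredSpace X)
    {K : Set X} (hK : IsClosed K) (hinf : K.Infinite) :
    ∃ a : Ordinal.{u}, a ≠ 0 ∧ (iteratedDerivedSet K a).Finite ∧
      (iteratedDerivedSet K a).Nonempty := by
  have := h.compact
  have := h.hausdorff
  have hempty : perfectKernel K = ∅ := by
    by_contra hne
    obtain ⟨x, hx, U, hU, hUx⟩ := h.exists_isolated _ (Set.nonempty_iff_ne_empty.2 hne)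
    have hxU : x ∈ U := (hUx.symm ▸ Set.mem_singleton x : x ∈ U ∩ perfectKernel K).1
    obtain ⟨y, hy, hyx⟩ := preperfect_iff_nhds.1 (perfect_perfectKernel hK).acc x hx U
      (hU.mem_nhds hxU)
    rw [hUx] at hy
    exact hyx hy
  have hex : ∃ a : Ordinal.{u}, (iteratedDerivedSet K a).Finite := by
    obtain ⟨a, ha⟩ := iteratedDerivedSet_mem_fixedPoints K
    refine ⟨a, ?_⟩
    rw [← perfectKernel_eq_iteratedDerivedSet_of_mem_fixedPoints ha, hempty]
    exact Set.finite_empty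
  obtain ⟨a, ha, hmin⟩ := wellFounded_lt.has_min {a : Ordinal.{u} | (iteratedDerivedSet K a).Finite}
    hex
  have hlt : ∀ b < a, (iteratedDerivedSet K b).Infinite := fun b hb hf => hmin b hf hb
  have ha0 : a ≠ 0 := by
    rintro rfl
    exact hinf (by simpa using ha)
  refine ⟨a, ha0, ha, ?_⟩
  rcases Ordinal.zero_or_succ_or_isSuccLimit a with h0 | ⟨b, rfl⟩ | hlim
  · exact (ha0 h0).elim
  · have hb := hlt b (by simp)
    have hcl := isClosed_iteratedDerivedSet hK b
    obtain ⟨x, -, hx⟩ := hb.exists_accPt_of_subset_isCompact hcl.isCompact subset_rfl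
    refine ⟨x, ?_⟩
    rw [Order.succ_eq_add_one, iteratedDerivedSet_succ, hcl.relDerivedSet_eq]
    exact hx
  · rw [iteratedDerivedSet_limit hlim]
    have : Nonempty (Set.Iio a) := ⟨⟨0, hlim.bot_lt⟩⟩
    refine IsCompact.nonempty_iInter_of_directed_nonempty_isCompact_isClosed _ ?_
      (fun b => (hlt b b.2).nonempty)
      (fun b => (isClosed_iteratedDerivedSet hK b).isCompact)
      (fun b => isClosed_iteratedDerivedSet hK b)
    exact directed_of_isDirected_le fun b c hbc =>
      iteratedDerivedSet_antitone K (Subtype.coe_le_coe.2 hbc)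

end Derivative

/-! ### Splitting a set at an accumulation point -/

/-- By recursion the truth value flips at each successor; it is false at points that are not
successors. -/
theorem exists_alternating_predicate (S : Type*) [LinearOrder S] [WellFoundedLT S]
    [NoMaxOrder S] : ∃ p : S → Prop, ∀ x : S, ∃ y, x < y ∧ (p y ↔ ¬ p x) := by
  classical
  let _ : SuccOrder S := SuccOrder.ofLinearWellFoundedLT S
  let F : ∀ x : S, (∀ y, y < x → Prop) → Prop := fun x ih =>
    ∃ (y : S) (h : y < x), Order.succ y = x ∧ ¬ ih y h
  refine ⟨wellFounded_lt.fix F, fun x => ⟨Order.succ x, Order.lt_succ x, ?_⟩⟩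
  rw [WellFounded.fix_eq]
  constructor
  · rintro ⟨y, _, hy, hp⟩
    obtain rfl := Order.succ_injective hy
    exact hp
  · exact fun hp => ⟨x, Order.lt_succ x, rfl, hp⟩

/-- A linear order without maximum can be split into two cofinal parts. -/
theorem exists_isCofinal_compl (α : Type*) [LinearOrder α] [NoMaxOrder α] :
    ∃ B : Set α, IsCofinal B ∧ IsCofinal Bᶜ := by
  let r : α → α → Prop := WellOrderingRel
  have wf : WellFounded r := IsWellFounded.wf
  -- The record points of the well-ordering `r`: they are cofinal, and on them `<` implies `r`,
  -- hence is well-founded.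
  let S : Set α := {x | ∀ y, r y x → y < x}
  have hcof : ∀ z, ∃ x ∈ S, z ≤ x := by
    intro z
    obtain ⟨x, hx, hmin⟩ := wf.has_min {x | z ≤ x} ⟨z, le_refl z⟩
    exact ⟨x, fun y hy => (not_le.1 fun h => hmin y h hy).trans_le hx, hx⟩
  have hlt : ∀ x y : S, x < y → r x y := by
    intro x y hxy
    rcases trichotomous_of r (x : α) y with h | h | h
    · exact h
    · exact absurd h (ne_of_lt (Subtype.coe_lt_coe.2 hxy))
    · exact absurd (x.2 _ h) (not_lt.2 (Subtype.coe_le_coe.2 hxy.le))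
  have : WellFoundedLT S := ⟨Subrelation.wf (fun {x y} h => hlt x y h)
    (InvImage.wf (Subtype.val : S → α) wf)⟩
  have : NoMaxOrder S := by
    refine ⟨fun x => ?_⟩
    obtain ⟨y, hy⟩ := exists_gt (x : α)
    obtain ⟨z, hz, hyz⟩ := hcof y
    exact ⟨⟨z, hz⟩, hy.trans_le hyz⟩
  obtain ⟨p, hp⟩ := exists_alternating_predicate S
  refine ⟨{x | ∃ h : x ∈ S, p ⟨x, h⟩}, fun z => ?_, fun z => ?_⟩
  · obtain ⟨x, hx, hzx⟩ := hcof z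
    by_cases h : p ⟨x, hx⟩
    · exact ⟨x, ⟨hx, h⟩, hzx⟩
    · obtain ⟨y, hy, hpy⟩ := hp ⟨x, hx⟩
      exact ⟨y, ⟨y.2, hpy.2 h⟩, hzx.trans (Subtype.coe_le_coe.2 hy.le)⟩
  · obtain ⟨x, hx, hzx⟩ := hcof z
    by_cases h : p ⟨x, hx⟩
    · obtain ⟨y, hy, hpy⟩ := hp ⟨x, hx⟩
      exact ⟨y, fun ⟨_, hy'⟩ => hpy.1 hy' h, hzx.trans (Subtype.coe_le_coe.2 hy.le)⟩
    · exact ⟨x, fun ⟨_, hx'⟩ => h hx', hzx⟩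

/-- Take in each fibre over `A` the greatest point below `y`. These points converge to `y` from the
left and `f` is injective on them, so two complementary cofinal sets of them have disjoint images,
both accumulating at `f y`. -/
theorem exists_split_closure_of_left {X : Type u} {Y : Type v} [TopologicalSpace X] [T1Space X]
    [TopologicalSpace Y] [CompactSpace Y] [LinearOrder Y] [OrderTopology Y] {f : Y → X}
    (hf : Continuous f) {A : Set X} {y : Y} (hy : f y ∉ A)
    (hcl : y ∈ closure (f ⁻¹' A ∩ Set.Iio y)) :
    ∃ B ⊆ A, f y ∈ closure B ∧ f y ∈ closure (A \ B) := by
  let T : Set Y := {t | t < y ∧ f t ∈ A ∧ ∀ t', t' ≤ y → f t' = f t → t' ≤ t}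
  have hT : ∀ l < y, ∃ t ∈ T, l < t := by
    intro l hl
    obtain ⟨t, hlt, htA, hty⟩ := mem_closure_iff.1 hcl _ isOpen_Ioi hl
    have hK : IsCompact (f ⁻¹' {f t} ∩ Set.Iic y) :=
      ((isClosed_singleton.preimage hf).inter isClosed_Iic).isCompact
    obtain ⟨s, ⟨hs1, hs2⟩, hs3⟩ := hK.exists_isGreatest ⟨t, rfl, le_of_lt hty⟩
    have hs1 : f s = f t := hs1
    have hst : t ≤ s := hs3 ⟨rfl, le_of_lt hty⟩
    refine ⟨s, ⟨lt_of_le_of_ne hs2 ?_, ?_, ?_⟩, lt_of_lt_of_le hlt hst⟩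
    · rintro rfl
      exact hy (hs1 ▸ htA)
    · rw [hs1]; exact htA
    · intro t' ht' hft'
      exact hs3 ⟨hft'.trans hs1, ht'⟩
  have : NoMaxOrder T := by
    refine ⟨fun t => ?_⟩
    obtain ⟨s, hs, hts⟩ := hT t t.2.1
    exact ⟨⟨s, hs⟩, hts⟩
  obtain ⟨B, hB, hB'⟩ := exists_isCofinal_compl T
  have hclos : ∀ C : Set T, IsCofinal C → f y ∈ closure (f '' (Subtype.val '' C)) := by
    intro C hC
    refine image_closure_subset_closure_image hf (Set.mem_image_of_mem f ?_)
    rw [mem_closure_iff_nhds]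
    intro U hU
    have hex : ∃ l, l < y := by
      obtain ⟨t, -, ht⟩ := closure_nonempty_iff.1 ⟨y, hcl⟩
      exact ⟨t, ht⟩
    obtain ⟨l, hl, hlU⟩ := exists_Ioc_subset_of_mem_nhds hU hex
    obtain ⟨t, ht, hlt⟩ := hT l hl
    obtain ⟨c, hc, htc⟩ := hC ⟨t, ht⟩
    exact ⟨c, hlU ⟨hlt.trans_le htc, c.2.1.le⟩, c, hc, rfl⟩
  refine ⟨f '' (Subtype.val '' B), ?_, hclos B hB, closure_mono ?_ (hclos _ hB')⟩
  · rintro _ ⟨_, ⟨t, -, rfl⟩, rfl⟩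
    exact t.2.2.1
  · rintro _ ⟨_, ⟨t, ht, rfl⟩, rfl⟩
    refine ⟨t.2.2.1, ?_⟩
    rintro ⟨_, ⟨s, hs, rfl⟩, hst⟩
    have h1 := t.2.2.2 s s.2.1.le hst
    have h2 := s.2.2.2 t t.2.1.le hst.symm
    exact ht (Subtype.ext (le_antisymm h2 h1) ▸ hs)

/-- In a continuous image of a compact interval space, the trace of the neighbourhood filter of an
accumulation point on a set is never an ultrafilter. -/
theorem IsContinuousImageOfCompactIntervalSpace.exists_split_closure
    {X : Type u} [TopologicalSpace X] [T2Space X]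
    (h : IsContinuousImageOfCompactIntervalSpace.{u, v} X) {A : Set X} {e : X}
    (he : e ∈ closure A) (heA : e ∉ A) :
    ∃ B ⊆ A, e ∈ closure B ∧ e ∈ closure (A \ B) := by
  obtain ⟨Y, _, _, ⟨_, _⟩, f, hf, hsurj⟩ := h
  have h1 : closure A ⊆ f '' closure (f ⁻¹' A) := by
    refine closure_minimal ?_ (hf.isClosedMap _ isClosed_closure)
    intro a ha
    obtain ⟨y, rfl⟩ := hsurj a
    exact ⟨y, subset_closure ha, rfl⟩
  obtain ⟨y, hy, rfl⟩ := h1 he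
  have h2 : f ⁻¹' A = (f ⁻¹' A ∩ Set.Iio y) ∪ (f ⁻¹' A ∩ Set.Ioi y) := by
    ext t
    constructor
    · intro ht
      rcases lt_trichotomy t y with h | rfl | h
      · exact Or.inl ⟨ht, h⟩
      · exact (heA ht).elim
      · exact Or.inr ⟨ht, h⟩
    · rintro (ht | ht) <;> exact ht.1
  rw [h2, closure_union] at hy
  rcases hy with hy | hy
  · exact exists_split_closure_of_left hf heA hy
  · have : CompactSpace Yᵒᵈ := inferInstanceAs (CompactSpace Y)
    exact exists_split_closure_of_left (Y := Yᵒᵈ) (f := f ∘ OrderDual.ofDual)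
      (y := OrderDual.toDual y) hf heA hy

/-- A property of points in topological spaces. -/
abbrev PointProperty : Type (u + 1) := ∀ (X : Type u) [TopologicalSpace X], X → Prop

/-- A property of points which depends only on small clopen neighbourhoods of the point. -/
structure PointProperty.IsLocal (P : PointProperty.{u}) : Prop where
  iff : ∀ {X Z : Type u} [TopologicalSpace X] [TopologicalSpace Z] {i : Z → X}, IsOpenEmbedding i →
    IsClosedEmbedding i → ∀ z, P X (i z) ↔ P Z z

/-- Every point of a compact Hausdorff space with the property `P` has the property `R` in some
closed subspace. -/
def PointProperty.ShrinksTo (P R : PointProperty.{u}) : Prop :=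
  ∀ (X : Type u) [TopologicalSpace X] [CompactSpace X] [T2Space X] (x : X), P X x →
    ∃ T : Set X, IsClosed T ∧ ∃ h : x ∈ T, R T ⟨x, h⟩

/-- Two mutually exclusive local properties such that the points having one of them are isolated
from one another, and such that a point with the first property has the second property in
some closed subspace. -/
structure IsShrinkablePair (P Q : PointProperty.{u}) : Prop where
  left_local : P.IsLocal
  right_local : Q.IsLocal
  isolated : ∀ {X : Type u} [TopologicalSpace X] {x : X}, P X x ∨ Q X x →
    ∃ V : Set X, IsOpen V ∧ x ∈ V ∧ ∀ y ∈ V, y ≠ x → ¬ P X y ∧ ¬ Q X y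
  not_both : ∀ {X : Type u} [TopologicalSpace X] {x : X}, P X x → ¬ Q X x
  shrinksTo : P.ShrinksTo Q

/-! ### Shrinkable pairs in CO spaces -/

section

variable {X : Type u} [TopologicalSpace X]

theorem PointProperty.IsLocal.clopen_iff {P : PointProperty.{u}} (hP : P.IsLocal) {W : Set X}
    (hW : IsClopen W) (z : W) : P X z ↔ P W z :=
  hP.iff hW.isOpen.isOpenEmbedding_subtypeVal hW.isClosed.isClosedEmbedding_subtypeVal z

/-- `T` is clopen in `F`. This is how properties arranged inside a single `W a` are read off in the
assembled closed set. -/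
theorem PointProperty.IsLocal.inter_iff {P : PointProperty.{u}} (hP : P.IsLocal) {F W T : Set X}
    (hW : IsClopen W) (hFW : F ∩ W = T) {x : X} (hxT : x ∈ T) (hxF : x ∈ F) :
    P F ⟨x, hxF⟩ ↔ P T ⟨x, hxT⟩ := by
  have hTF : T ⊆ F := hFW ▸ Set.inter_subset_left
  have hemb : IsEmbedding (Set.inclusion hTF) := .inclusion hTF
  have hrange : Set.range (Set.inclusion hTF) = Subtype.val ⁻¹' W := by
    rw [Set.range_inclusion]
    ext z
    constructor
    · intro hz
      exact (hFW.symm ▸ hz : (z : X) ∈ F ∩ W).2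
    · intro hz
      exact hFW ▸ ⟨z.2, hz⟩
  have hcl : IsClopen (Set.range (Set.inclusion hTF)) :=
    hrange ▸ hW.preimage continuous_subtype_val
  exact hP.iff ⟨hemb, hcl.isOpen⟩ ⟨hemb, hcl.isClosed⟩ ⟨x, hxT⟩

theorem IsCOSpace.exists_embedding (h : IsCOSpace X) {F : Set X} (hF : IsClosed F) :
    ∃ j : F → X, IsOpenEmbedding j ∧ IsClosedEmbedding j := by
  obtain ⟨U, hU, ⟨e⟩⟩ := h F hF
  exact ⟨Subtype.val ∘ e, hU.isOpen.isOpenEmbedding_subtypeVal.comp e.isOpenEmbedding,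
    hU.isClosed.isClosedEmbedding_subtypeVal.comp e.isClosedEmbedding⟩

open CantorBendixson in
-- Let `N` be the `a`-th derivative, taken in `F`, of the closure of the `P`-points of `F`. It
-- contains `E`, and `j` maps it into `E` because `j` preserves `P`. As `E` is finite, `j '' N = E`.
theorem IsCOSpace.exists_embedding_image_eq (h : IsCOSpace X) {P : PointProperty.{u}}
    (hP : P.IsLocal) {a : Ordinal.{u}} {E : Set X}
    (hE : E = iteratedDerivedSet (closure {x | P X x}) a) (hfin : E.Finite) {F : Set X}
    (hF : IsClosed F) {B : Set X} (hB : ∀ b ∈ B, ∃ hb : b ∈ F, P F ⟨b, hb⟩)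
    (hEB : E ⊆ iteratedDerivedSet (closure B) a) :
    ∃ j : F → X, IsOpenEmbedding j ∧ IsClosedEmbedding j ∧
      (∀ e ∈ E, ∃ z : F, j z = e) ∧ ∀ e ∈ E, ∃ hz : e ∈ F, j ⟨e, hz⟩ ∈ E := by
  obtain ⟨j, hjo, hjc⟩ := h.exists_embedding hF
  have hι : IsClosedEmbedding (Subtype.val : F → X) := hF.isClosedEmbedding_subtypeVal
  let N : Set F := iteratedDerivedSet (closure {z : F | P F z}) a
  have h1 : E ⊆ Subtype.val '' N := by
    rw [image_iteratedDerivedSet hι.isEmbedding, ← hι.closure_image_eq]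
    refine hEB.trans (iteratedDerivedSet_mono (closure_mono ?_) a)
    intro b hb
    obtain ⟨hbF, hPb⟩ := hB b hb
    exact ⟨⟨b, hbF⟩, hPb, rfl⟩
  have h2 : j '' N ⊆ E := by
    rw [image_iteratedDerivedSet hjc.isEmbedding, ← hjc.closure_image_eq, hE]
    refine iteratedDerivedSet_mono (closure_mono ?_) a
    rintro _ ⟨z, hz, rfl⟩
    exact (hP.iff hjo hjc z).2 hz
  have h3 : j '' N = E := by
    refine Set.eq_of_subset_of_ncard_le h2 ?_ hfin
    rw [Set.ncard_image_of_injective _ hjc.injective,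
      ← Set.ncard_image_of_injective N hι.injective]
    refine Set.ncard_le_ncard h1 (Set.Finite.image _ ?_)
    exact Set.Finite.of_finite_image (hfin.subset h2) hjc.injective.injOn
  refine ⟨j, hjo, hjc, fun e he => ?_, fun e he => ?_⟩
  · rw [← h3] at he
    obtain ⟨z, -, hz⟩ := he
    exact ⟨z, hz⟩
  · obtain ⟨z, hz, rfl⟩ := h1 he
    exact ⟨z.2, h2 (Set.mem_image_of_mem j hz)⟩

theorem PointProperty.ShrinksTo.exists_subset {P Q : PointProperty.{u}}
    (h : P.ShrinksTo Q) (hP : P.IsLocal) (hQ : Q.IsLocal) [CompactSpace X] [T2Space X] {x : X}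
    (hx : P X x) {W : Set X} (hW : IsClopen W) (hxW : x ∈ W) :
    ∃ T : Set X, IsClosed T ∧ T ⊆ W ∧ ∃ h : x ∈ T, Q T ⟨x, h⟩ := by
  have : CompactSpace W := isCompact_iff_compactSpace.1 hW.isClosed.isCompact
  obtain ⟨T, hT, hxT, hQT⟩ := h W ⟨x, hxW⟩ ((hP.clopen_iff hW ⟨x, hxW⟩).1 hx)
  let i : T → (Subtype.val '' T : Set X) := fun t => ⟨t.1.1, t.1, t.2, rfl⟩
  have hi : IsEmbedding i :=
    (IsEmbedding.subtypeVal.comp IsEmbedding.subtypeVal).codRestrict (Subtype.val '' T)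
      fun t => Set.mem_image_of_mem Subtype.val t.2
  have hr : Set.range i = Set.univ := by
    ext ⟨_, t, ht, rfl⟩
    simp only [Set.mem_range, Set.mem_univ, iff_true]
    exact ⟨⟨t, ht⟩, rfl⟩
  refine ⟨Subtype.val '' T, hW.isClosed.isClosedMap_subtype_val _ hT, ?_, ⟨⟨x, hxW⟩, hxT, rfl⟩, ?_⟩
  · rintro _ ⟨t, -, rfl⟩
    exact t.2
  · exact (hQ.iff ⟨hi, hr ▸ isOpen_univ⟩ ⟨hi, hr ▸ isClosed_univ⟩ ⟨⟨x, hxW⟩, hxT⟩).2 hQT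

open CantorBendixson in
/-- A splitting of a set `I` one of whose parts still has all of the finite last derivative
of `closure I` as its derivative, while the other part accumulates somewhere on it. -/
theorem exists_subset_iteratedDerivedSet_closure_diff [T2Space X]
    (hscat : IsScatteredSpace X) (himage : IsContinuousImageOfCompactIntervalSpace.{u, v} X)
    {I : Set X} {a : Ordinal.{u}} (hfin : (iteratedDerivedSet (closure I) a).Finite) {e : X}
    (he : e ∈ iteratedDerivedSet (closure I) a) (heI : e ∉ I) :
    ∃ B ⊆ I, e ∈ closure B ∧
      iteratedDerivedSet (closure I) a ⊆ iteratedDerivedSet (closure (I \ B)) a := by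
  set E := iteratedDerivedSet (closure I) a with hE
  have heK : e ∈ closure I := by
    have := iteratedDerivedSet_antitone (closure I) (zero_le (a := a)) he
    simpa using this
  obtain ⟨B, hBI, heB, heB'⟩ := himage.exists_split_closure heK heI
  -- `V` separates `e` from the rest of `E`; removing points of `I` inside `V` therefore does not
  -- affect the other points of `E`.
  obtain ⟨V, hV, heV, hVE⟩ := hscat.exists_isClopen (hfin.sdiff (t := {e})).isClosed.isOpen_compl
    (show e ∈ (E \ {e})ᶜ from fun h => h.2 rfl)
  have hcl : ∀ C : Set X, e ∈ closure C → e ∈ closure (C ∩ V) := by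
    intro C hC
    rw [mem_closure_iff] at hC ⊢
    intro O hO heO
    obtain ⟨y, hy, hyC⟩ := hC (O ∩ V) (hO.inter hV.isOpen) ⟨heO, heV⟩
    exact ⟨y, hy.1, hyC, hy.2⟩
  have hunion : ∀ s t : Set X, iteratedDerivedSet (closure (s ∪ t)) a =
      iteratedDerivedSet (closure s) a ∪ iteratedDerivedSet (closure t) a := fun s t => by
    rw [closure_union, iteratedDerivedSet_union isClosed_closure isClosed_closure]
  have hsub : ∀ (s : Set X) (C : Set X), IsClosed C → s ⊆ C →
      iteratedDerivedSet (closure s) a ⊆ C := by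
    intro s C hC hs x hx
    have := iteratedDerivedSet_antitone (closure s) (zero_le (a := a)) hx
    rw [iteratedDerivedSet_zero] at this
    exact closure_minimal hs hC this
  have hout : ∀ x ∈ E, x ≠ e → x ∈ iteratedDerivedSet (closure (I \ V)) a := by
    intro x hx hxe
    have h1 : I = (I ∩ V) ∪ (I \ V) := (Set.inter_union_sdiff I V).symm
    rw [hE, h1, hunion] at hx
    refine hx.resolve_left fun hxV => ?_
    have hxV' := hsub _ V hV.isClosed Set.inter_subset_right hxV
    refine hVE hxV' ⟨?_, hxe⟩
    rw [hE, h1, hunion]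
    exact Or.inl hxV
  have hin : e ∈ iteratedDerivedSet (closure (I ∩ V)) a := by
    have h1 : I = (I ∩ V) ∪ (I \ V) := (Set.inter_union_sdiff I V).symm
    have h2 := he
    rw [hE, h1, hunion] at h2
    refine h2.resolve_right fun h3 => ?_
    exact hsub _ Vᶜ hV.isOpen.isClosed_compl (fun y hy => hy.2) h3 heV
  have key : ∀ C ⊆ I, e ∈ closure C → e ∈ iteratedDerivedSet (closure ((I \ C) ∩ V)) a →
      ∃ B ⊆ I, e ∈ closure B ∧ E ⊆ iteratedDerivedSet (closure (I \ B)) a := by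
    intro C hC heC heC'
    refine ⟨C ∩ V, Set.inter_subset_left.trans hC, hcl C heC, fun x hx => ?_⟩
    by_cases hxe : x = e
    · subst hxe
      refine iteratedDerivedSet_mono (closure_mono ?_) a heC'
      exact fun y hy => ⟨hy.1.1, fun h => hy.1.2 h.1⟩
    · refine iteratedDerivedSet_mono (closure_mono ?_) a (hout x hx hxe)
      exact fun y hy => ⟨hy.1, fun h => hy.2 h.2⟩
  -- Derivatives of closed sets are additive, so one half still has `e` in its derivative. The other
  -- half, which merely accumulates at `e`, is the one to remove.
  have h1 : I ∩ V = ((I \ B) ∩ V) ∪ (B ∩ V) := by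
    rw [← Set.union_inter_distrib_right, Set.sdiff_union_of_subset hBI]
  rw [h1, hunion] at hin
  rcases hin with hin | hin
  · exact key B hBI heB hin
  · refine key (I \ B) Set.sdiff_subset heB' ?_
    rwa [Set.sdiff_sdiff_cancel_left hBI]

/-- In a scattered CO space which is a continuous image of a compact interval space, only finitely
many points have the first property of a shrinkable pair. -/
theorem IsShrinkablePair.finite {P Q : PointProperty.{u}} (hPQ : IsShrinkablePair P Q)
    (hscat : IsScatteredSpace X) (himage : IsContinuousImageOfCompactIntervalSpace.{u, v} X)
    (hCO : IsCOSpace X) : {x : X | P X x}.Finite := by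
  classical
  have := hscat.compact
  have := hscat.hausdorff
  by_contra hinf
  set I : Set X := {x : X | P X x} with hI
  obtain ⟨a, ha0, hfin, e, he⟩ := hscat.exists_finite_nonempty_iteratedDerivedSet
    (isClosed_closure (s := I)) (fun h => hinf (h.subset subset_closure))
  set E := CantorBendixson.iteratedDerivedSet (closure I) a with hE
  have hO : ∀ x : X, ∃ V : Set X, P X x → IsOpen V ∧ x ∈ V ∧
      ∀ y ∈ V, y ≠ x → ¬ P X y ∧ ¬ Q X y := by
    intro x
    by_cases hx : P X x
    · obtain ⟨V, hV⟩ := hPQ.isolated (Or.inl hx)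
      exact ⟨V, fun _ => hV⟩
    · exact ⟨∅, fun h => (hx h).elim⟩
  choose O hO using hO
  have hOI : ∀ x ∈ I, O x ∩ I = {x} := by
    intro x hx
    ext y
    constructor
    · rintro ⟨hy, hyI⟩
      by_contra hne
      exact ((hO x hx).2.2 y hy hne).1 hyI
    · rintro rfl
      exact ⟨(hO _ hx).2.1, hx⟩
  have heI : e ∉ I := by
    intro heI
    have h1 := iteratedDerivedSet_subset_derivedSet _ ha0 he
    rw [derivedSet_closure, mem_derivedSet, accPt_iff_nhds] at h1
    obtain ⟨y, hy, hye⟩ := h1 _ ((hO e heI).1.mem_nhds (hO e heI).2.1)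
    rw [hOI e heI] at hy
    exact hye hy
  obtain ⟨H, hH⟩ := himage.exists_monotoneNormalityOperator
  obtain ⟨W, hW, hWT⟩ := hscat.exists_expansion (I := I) hH (fun x hx => (hO x hx).1) hOI
  -- all points of `I` keep their neighbourhoods
  have hfree : ∃ G : Set X, IsOpen G ∧ E ⊆ G ∧ ∀ x ∈ G, ¬ Q X x := by
    obtain ⟨hF, hFW⟩ := hWT W fun a ha => ⟨(hW a ha).1.isClosed, (hW a ha).2.1, subset_rfl⟩
    set F := closure I ∪ ⋃ a ∈ I, W a
    have hPF : ∀ b ∈ I, ∃ hb : b ∈ F, P F ⟨b, hb⟩ := by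
      intro b hb
      have hbF : b ∈ F := Or.inl (subset_closure hb)
      refine ⟨hbF, ?_⟩
      rw [hPQ.left_local.inter_iff (hW b hb).1 (hFW b hb) (hW b hb).2.1 hbF]
      exact (hPQ.left_local.clopen_iff (hW b hb).1 ⟨b, (hW b hb).2.1⟩).1 hb
    obtain ⟨j, hjo, hjc, hj, -⟩ := hCO.exists_embedding_image_eq hPQ.left_local hE hfin hF hPF
      subset_rfl
    refine ⟨Set.range j, hjo.isOpen_range, hj, ?_⟩
    -- No point of `F` has `Q`: inside `W b` this is excluded by `not_both` and the choice of `O b`,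
    -- and any other point is a limit of `P`-points, against `isolated`.
    rintro _ ⟨⟨z, hzF⟩, rfl⟩ hQ
    rw [hPQ.right_local.iff hjo hjc] at hQ
    by_cases hzW : ∃ b ∈ I, z ∈ W b
    · obtain ⟨b, hb, hzb⟩ := hzW
      rw [hPQ.right_local.inter_iff (hW b hb).1 (hFW b hb) hzb,
        ← hPQ.right_local.clopen_iff (hW b hb).1 ⟨z, hzb⟩] at hQ
      by_cases hzb' : z = b
      · subst hzb'
        exact hPQ.not_both hb hQ
      · exact ((hO b hb).2.2 z ((hW b hb).2.2 hzb) hzb').2 hQ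
    · push Not at hzW
      have hzI : z ∈ closure I := by
        refine hzF.resolve_right fun h => ?_
        simp only [Set.mem_iUnion] at h
        obtain ⟨b, hb, hzb⟩ := h
        exact hzW b hb hzb
      obtain ⟨V, hV, hzV, hVPQ⟩ := hPQ.isolated (Or.inr hQ)
      obtain ⟨V', hV', rfl⟩ := isOpen_induced_iff.1 hV
      obtain ⟨b, hbV, hb⟩ := mem_closure_iff.1 hzI V' hV' hzV
      obtain ⟨hbF, hPb⟩ := hPF b hb
      refine (hVPQ ⟨b, hbF⟩ hbV fun h => ?_).1 hPb
      have hbz : b = z := congrArg Subtype.val h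
      exact hzW b hb (hbz ▸ (hW b hb).2.1)
  -- a part of `I` accumulating at `e` is shrunk
  obtain ⟨B, hBI, heB, hEB⟩ := exists_subset_iteratedDerivedSet_closure_diff hscat himage hfin he heI
  have hS : ∀ x : X, ∃ T : Set X, x ∈ I → IsClosed T ∧ T ⊆ W x ∧ ∃ h : x ∈ T, Q T ⟨x, h⟩ := by
    intro x
    by_cases hx : x ∈ I
    · obtain ⟨T, hT⟩ := hPQ.shrinksTo.exists_subset hPQ.left_local hPQ.right_local hx
        (hW x hx).1 (hW x hx).2.1
      exact ⟨T, fun _ => hT⟩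
    · exact ⟨∅, fun h => (hx h).elim⟩
  choose S hS using hS
  let T : X → Set X := fun x => if x ∈ B then S x else W x
  obtain ⟨hF, hFW⟩ := hWT T fun x hx => by
    by_cases hxB : x ∈ B
    · simp only [T, hxB, if_true]
      exact ⟨(hS x hx).1, (hS x hx).2.2.1, (hS x hx).2.1⟩
    · simp only [T, hxB, if_false]
      exact ⟨(hW x hx).1.isClosed, (hW x hx).2.1, subset_rfl⟩
  set F := closure I ∪ ⋃ a ∈ I, T a
  have hmem : ∀ b ∈ I, b ∈ F := fun b hb => Or.inl (subset_closure hb)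
  have hPF : ∀ b ∈ I \ B, ∃ hb : b ∈ F, P F ⟨b, hb⟩ := by
    rintro b ⟨hb, hbB⟩
    have hT : F ∩ W b = W b := by
      rw [hFW b hb]; simp only [T, hbB, if_false]
    refine ⟨hmem b hb, ?_⟩
    rw [hPQ.left_local.inter_iff (hW b hb).1 hT (hW b hb).2.1 (hmem b hb)]
    exact (hPQ.left_local.clopen_iff (hW b hb).1 ⟨b, (hW b hb).2.1⟩).1 hb
  obtain ⟨j, hjo, hjc, -, hj⟩ := hCO.exists_embedding_image_eq hPQ.left_local hE hfin hF hPF hEB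
  obtain ⟨heF, hje⟩ := hj e he
  obtain ⟨G, hG, hEG, hGQ⟩ := hfree
  -- Since `j e ∈ E ⊆ G`, points of `B` close to `e` are sent into `G`, although they have been made
  -- `Q`-points.
  have hpre : j ⁻¹' G ∈ 𝓝 (⟨e, heF⟩ : F) := (hG.preimage hjc.continuous).mem_nhds (hEG hje)
  rw [nhds_subtype_eq_comap, Filter.mem_comap] at hpre
  obtain ⟨V, hV, hVG⟩ := hpre
  obtain ⟨b, hbV, hbB⟩ := mem_closure_iff_nhds.1 heB V hV
  have hb := hBI hbB
  have hT : F ∩ W b = S b := by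
    rw [hFW b hb]; simp only [T, hbB, if_true]
  obtain ⟨-, -, hbS, hQ⟩ := hS b hb
  refine hGQ _ (hVG (show (⟨b, hmem b hb⟩ : F) ∈ _ from hbV)) ?_
  rw [hPQ.right_local.iff hjo hjc, hPQ.right_local.inter_iff (hW b hb).1 hT hbS]
  exact hQ

end

/-- If `P` is one property of a shrinkable pair and every point with the property `P` can be given
the stronger property `R` in a closed subspace, then it has the property `R` already. -/
theorem IsShrinkablePair.of_shrinksTo {P Q R : PointProperty.{u}} (hPQ : IsShrinkablePair P Q)
    (hR : R.IsLocal) (hPR : P.ShrinksTo R)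
    (hRP : ∀ (X : Type u) [TopologicalSpace X] (x : X), R X x → P X x)
    {X : Type u} [TopologicalSpace X] (hscat : IsScatteredSpace X)
    (himage : IsContinuousImageOfCompactIntervalSpace.{u, v} X) (hCO : IsCOSpace X) {x : X}
    (hx : P X x) : R X x := by
  have := hscat.compact
  have := hscat.hausdorff
  have hfin := hPQ.finite hscat himage hCO
  set I : Set X := {x : X | P X x} with hI
  obtain ⟨H, hH⟩ := himage.exists_monotoneNormalityOperator
  obtain ⟨W, hW, hWT⟩ := hscat.exists_expansion (I := I) (O := fun x => (I \ {x})ᶜ) hH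
    (fun a _ => (hfin.sdiff (t := {a})).isClosed.isOpen_compl) (by
      intro a ha
      ext y
      simp only [Set.mem_inter_iff, Set.mem_compl_iff, Set.mem_sdiff, Set.mem_singleton_iff, not_and,
        not_not]
      exact ⟨fun h => h.1 h.2, fun h => ⟨fun _ => h, h ▸ ha⟩⟩)
  have hS : ∀ x : X, ∃ T : Set X, x ∈ I → IsClosed T ∧ T ⊆ W x ∧ ∃ h : x ∈ T, R T ⟨x, h⟩ := by
    intro x
    by_cases hx : x ∈ I
    · obtain ⟨T, hT⟩ := hPR.exists_subset hPQ.left_local hR hx (hW x hx).1 (hW x hx).2.1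
      exact ⟨T, fun _ => hT⟩
    · exact ⟨∅, fun h => (hx h).elim⟩
  choose S hS using hS
  obtain ⟨hF, hFW⟩ := hWT S fun x hx => ⟨(hS x hx).1, (hS x hx).2.2.1, (hS x hx).2.1⟩
  set F := closure I ∪ ⋃ a ∈ I, S a
  have hRF : ∀ b (hb : b ∈ I), R F ⟨b, Or.inl (subset_closure hb)⟩ := by
    intro b hb
    obtain ⟨-, -, hbS, hRS⟩ := hS b hb
    exact (hR.inter_iff (hW b hb).1 (hFW b hb) hbS _).2 hRS
  obtain ⟨j, hjo, hjc⟩ := hCO.exists_embedding hF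
  have hj : ∀ b : I, R X (j ⟨b, Or.inl (subset_closure b.2)⟩) := fun b =>
    (hR.iff hjo hjc _).2 (hRF b b.2)
  -- An injective self-map of a finite set is onto, so `x` is the image of a point that was given
  -- `R`.
  let g : I → I := fun b => ⟨j ⟨b, Or.inl (subset_closure b.2)⟩, hRP X _ (hj b)⟩
  have hg : Function.Injective g := by
    intro b c hbc
    have h1 := hjc.injective (congrArg Subtype.val hbc)
    exact Subtype.ext (Subtype.mk.inj h1)
  have : Finite I := hfin
  obtain ⟨b, hb⟩ := Finite.injective_iff_surjective.1 hg ⟨x, hx⟩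
  have h1 := hj b
  rwa [show j ⟨b, Or.inl (subset_closure b.2)⟩ = x from congrArg Subtype.val hb] at h1

/-- Only finitely many points can be given the first property of a shrinkable pair in a closed
subspace. -/
theorem IsShrinkablePair.finite_setOf_exists_isClosed {P Q : PointProperty.{u}}
    (hPQ : IsShrinkablePair P Q) {X : Type u} [TopologicalSpace X] (hscat : IsScatteredSpace X)
    (himage : IsContinuousImageOfCompactIntervalSpace.{u, v} X) (hCO : IsCOSpace X) :
    {x : X | ∃ F : Set X, IsClosed F ∧ ∃ h : x ∈ F, P F ⟨x, h⟩}.Finite := by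
  have := hscat.hausdorff
  by_contra hinf
  set S := {x : X | ∃ F : Set X, IsClosed F ∧ ∃ h : x ∈ F, P F ⟨x, h⟩}
  have : Infinite S := Set.infinite_coe_iff.2 hinf
  -- An infinite Hausdorff space contains an infinite discrete subspace; only such a set can be
  -- expanded.
  obtain ⟨f, hf⟩ := exists_topology_isEmbedding_nat S
  have hgf : IsEmbedding (fun n => (f n : X)) := IsEmbedding.subtypeVal.comp hf
  set I : Set X := Set.range fun n => (f n : X) with hI
  have hIinf : I.Infinite := Set.infinite_range_of_injective hgf.injective
  have hO : ∀ n, ∃ O : Set X, IsOpen O ∧ O ∩ I = {(f n : X)} := by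
    intro n
    obtain ⟨O, hO, hOn⟩ := hgf.isOpen_iff.1 (isOpen_discrete ({n} : Set ℕ))
    refine ⟨O, hO, ?_⟩
    ext y
    constructor
    · rintro ⟨hy, m, rfl⟩
      have : m ∈ ({n} : Set ℕ) := hOn ▸ hy
      rw [Set.mem_singleton_iff.1 this]
      rfl
    · rintro rfl
      exact ⟨(hOn.symm ▸ Set.mem_singleton n : n ∈ (fun n => (f n : X)) ⁻¹' O), n, rfl⟩
  have hO' : ∀ a : X, ∃ O : Set X, a ∈ I → IsOpen O ∧ O ∩ I = {a} := by
    intro a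
    by_cases ha : a ∈ I
    · obtain ⟨n, rfl⟩ := ha
      obtain ⟨O, hO⟩ := hO n
      exact ⟨O, fun _ => hO⟩
    · exact ⟨∅, fun h => (ha h).elim⟩
  choose O hO using hO'
  have hIS : ∀ a : X, ∃ F : Set X, a ∈ I → IsClosed F ∧ ∃ h : a ∈ F, P F ⟨a, h⟩ := by
    intro a
    by_cases ha : a ∈ I
    · obtain ⟨n, rfl⟩ := ha
      obtain ⟨F, hF⟩ := (f n).2
      exact ⟨F, fun _ => hF⟩
    · exact ⟨∅, fun h => (ha h).elim⟩
  choose F hF using hIS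
  obtain ⟨H, hH⟩ := himage.exists_monotoneNormalityOperator
  obtain ⟨W, hW, hWT⟩ := hscat.exists_expansion (I := I) hH (fun a ha => (hO a ha).1)
    (fun a ha => (hO a ha).2)
  obtain ⟨hG, hGW⟩ := hWT (fun a => F a ∩ W a) fun a ha =>
    ⟨(hF a ha).1.inter (hW a ha).1.isClosed, ⟨(hF a ha).2.1, (hW a ha).2.1⟩, Set.inter_subset_right⟩
  set G := closure I ∪ ⋃ a ∈ I, F a ∩ W a
  obtain ⟨j, hjo, hjc⟩ := hCO.exists_embedding hG
  have hIG : I ⊆ G := fun a ha => Or.inl (subset_closure ha)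
  have hPj : ∀ a : I, P X (j ⟨a, hIG a.2⟩) := by
    rintro ⟨a, ha⟩
    obtain ⟨haF, hP⟩ := (hF a ha).2
    have haT : a ∈ F a ∩ W a := ⟨haF, (hW a ha).2.1⟩
    rw [hPQ.left_local.iff hjo hjc, hPQ.left_local.inter_iff (hW a ha).1 (hGW a ha) haT,
      ← hPQ.left_local.inter_iff (hW a ha).1 rfl haT haF]
    exact hP
  have : Infinite I := Set.infinite_coe_iff.2 hIinf
  have hinj : Function.Injective fun a : I => j ⟨a, hIG a.2⟩ := by
    intro b c hbc
    exact Subtype.ext (Subtype.mk.inj (hjc.injective hbc))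
  refine (Set.infinite_range_of_injective hinj) ((hPQ.finite hscat himage hCO).subset ?_)
  rintro _ ⟨a, rfl⟩
  exact hPj a

/-! ### Fans of isolated points -/

section Fan

/-- All points near `x`, except `x` itself, are isolated. -/
def IsIsolatedAround (X : Type u) [TopologicalSpace X] (x : X) : Prop :=
  ∃ V : Set X, IsOpen V ∧ x ∈ V ∧ ∀ y ∈ V, y ≠ x → IsOpen {y}

/-- Near `x` the space is an uncountable set of isolated points together with `x`. -/
def IsUncountableFanPoint : PointProperty.{u} := fun X _ x =>
  IsIsolatedAround X x ∧ ∀ V : Set X, IsOpen V → x ∈ V → ¬ V.Countable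

/-- Near `x` the space is a countable set of isolated points together with the non-isolated
point `x`. -/
def IsCountableFanPoint : PointProperty.{u} := fun X _ x =>
  IsIsolatedAround X x ∧ (∃ V : Set X, IsOpen V ∧ x ∈ V ∧ V.Countable) ∧ ¬ IsOpen {x}

variable {X Z : Type u} [TopologicalSpace X] [TopologicalSpace Z]

theorem _root_.Topology.IsOpenEmbedding.isOpen_singleton_iff {i : Z → X} (hi : IsOpenEmbedding i)
    {z : Z} : IsOpen {i z} ↔ IsOpen {z} := by
  rw [← Set.image_singleton, hi.isOpen_iff_image_isOpen]

theorem isIsolatedAround_iff {i : Z → X} (hi : IsOpenEmbedding i) (z : Z) :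
    IsIsolatedAround X (i z) ↔ IsIsolatedAround Z z := by
  constructor
  · rintro ⟨V, hV, hz, h⟩
    exact ⟨i ⁻¹' V, hV.preimage hi.continuous, hz, fun y hy hyz =>
      hi.isOpen_singleton_iff.1 (h (i y) hy fun h => hyz (hi.injective h))⟩
  · rintro ⟨V, hV, hz, h⟩
    refine ⟨i '' V, hi.isOpenMap V hV, Set.mem_image_of_mem i hz, ?_⟩
    rintro _ ⟨y, hy, rfl⟩ hyz
    exact hi.isOpen_singleton_iff.2 (h y hy fun h => hyz (h ▸ rfl))

theorem exists_countable_isOpen_iff {i : Z → X} (hi : IsOpenEmbedding i) (z : Z) :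
    (∃ V : Set X, IsOpen V ∧ i z ∈ V ∧ V.Countable) ↔
      ∃ V : Set Z, IsOpen V ∧ z ∈ V ∧ V.Countable := by
  constructor
  · rintro ⟨V, hV, hz, h⟩
    exact ⟨i ⁻¹' V, hV.preimage hi.continuous, hz, h.preimage_of_injOn hi.injective.injOn⟩
  · rintro ⟨V, hV, hz, h⟩
    exact ⟨i '' V, hi.isOpenMap V hV, Set.mem_image_of_mem i hz, h.image i⟩

theorem IsUncountableFanPoint.not_isOpen_singleton {x : X} (h : IsUncountableFanPoint X x) :
    ¬ IsOpen {x} := fun hx => h.2 {x} hx rfl (Set.countable_singleton x)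

/-- Keep `x` and a countably infinite set of the isolated points in a closed neighbourhood. What is
discarded there is open, so the remainder is closed; being compact and infinite, it cannot be
discrete, so `x` is not isolated in it. -/
theorem IsUncountableFanPoint.exists_isClosed [CompactSpace X] [T2Space X] {x : X}
    (h : IsUncountableFanPoint X x) :
    ∃ T : Set X, IsClosed T ∧ ∃ h : x ∈ T, IsCountableFanPoint T ⟨x, h⟩ := by
  obtain ⟨⟨V, hV, hxV, hVi⟩, hunc⟩ := h
  obtain ⟨N, hN, hNcl, hNV⟩ := exists_mem_nhds_isClosed_subset (hV.mem_nhds hxV)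
  have hNinf : (N \ {x}).Infinite := by
    intro hfin
    have h1 : (interior N).Countable := by
      refine ((hfin.union (Set.finite_singleton x)).countable).mono fun y hy => ?_
      by_cases hyx : y = x
      · exact Or.inr hyx
      · exact Or.inl ⟨interior_subset hy, hyx⟩
    exact hunc _ isOpen_interior (mem_interior_iff_mem_nhds.2 hN) h1
  obtain ⟨C, hCN, hCinf, hCc⟩ : ∃ C ⊆ N \ {x}, C.Infinite ∧ C.Countable := by
    have : Infinite (N \ {x} : Set X) := Set.infinite_coe_iff.2 hNinf
    let f := Infinite.natEmbedding (N \ {x} : Set X)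
    refine ⟨Set.range fun n => (f n : X), ?_, Set.infinite_range_of_injective
      (Subtype.val_injective.comp f.injective), Set.countable_range _⟩
    rintro _ ⟨n, rfl⟩
    exact (f n).2
  have hsubN : insert x C ⊆ N := Set.insert_subset (mem_of_mem_nhds hN) fun y hy => (hCN hy).1
  have hT : IsClosed (insert x C) := by
    rw [← isOpen_compl_iff, isOpen_iff_mem_nhds]
    intro y hy
    by_cases hyN : y ∈ N
    · have hyx : y ≠ x := fun h => hy (Or.inl h)
      refine Filter.mem_of_superset ((hVi y (hNV hyN) hyx).mem_nhds rfl) ?_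
      rintro _ rfl
      exact hy
    · exact Filter.mem_of_superset (hNcl.isOpen_compl.mem_nhds hyN)
        (Set.compl_subset_compl.2 hsubN)
  have hiso : ∀ y : (insert x C : Set X), y ≠ ⟨x, Or.inl rfl⟩ → IsOpen {y} := by
    intro y hy
    have h1 : IsOpen {(y : X)} := hVi y (hNV (hsubN y.2)) fun h => hy (Subtype.ext h)
    convert h1.preimage (continuous_subtype_val (p := (· ∈ insert x C))) using 1
    ext z
    simp [Subtype.ext_iff]
  refine ⟨insert x C, hT, Or.inl rfl, ⟨Set.univ, isOpen_univ, trivial, fun y _ => hiso y⟩,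
    ⟨Set.univ, isOpen_univ, trivial, ?_⟩, ?_⟩
  · rw [Set.countable_univ_iff]
    exact (hCc.insert x).to_subtype
  · intro hx
    have hd : DiscreteTopology (insert x C : Set X) := by
      rw [discreteTopology_iff_isOpen_singleton]
      intro y
      by_cases hy : y = ⟨x, Or.inl rfl⟩
      · exact hy ▸ hx
      · exact hiso y hy
    have : CompactSpace (insert x C : Set X) := isCompact_iff_compactSpace.1 hT.isCompact
    have hfin : Finite (insert x C : Set X) := finite_of_compact_of_discrete
    exact hCinf (Set.Finite.subset (Set.toFinite _) (Set.subset_insert x C))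

/-- Isolation holds because the neighbours of a fan point are isolated points, whereas fan points of
either kind are not. -/
theorem isShrinkablePair_fanPoint :
    IsShrinkablePair IsUncountableFanPoint.{u} IsCountableFanPoint.{u} where
  left_local := ⟨fun {X Z} _ _ {i} hi _ z => by
    have h := not_congr (exists_countable_isOpen_iff hi z)
    push Not at h
    exact and_congr (isIsolatedAround_iff hi z) h⟩
  right_local := ⟨fun {X Z} _ _ {i} hi _ z =>
    and_congr (isIsolatedAround_iff hi z) (and_congr (exists_countable_isOpen_iff hi z)
      (not_congr hi.isOpen_singleton_iff))⟩
  isolated := by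
    intro X _ x hx
    have h : IsIsolatedAround X x := hx.elim (fun h => h.1) fun h => h.1
    obtain ⟨V, hV, hxV, hVi⟩ := h
    exact ⟨V, hV, hxV, fun y hy hyx => ⟨fun h => h.not_isOpen_singleton (hVi y hy hyx),
      fun h => h.2.2 (hVi y hy hyx)⟩⟩
  not_both := by
    rintro X _ x ⟨-, h⟩ ⟨-, ⟨V, hV, hxV, hVc⟩, -⟩
    exact h V hV hxV hVc
  shrinksTo := fun X _ _ _ x h => h.exists_isClosed

open CantorBendixson in
-- The first derivative of `F` is the point at infinity alone, and `F` is neither finite nor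
-- preperfect, so the rank is 1. Neighbourhoods of infinity are cofinite, hence uncountable.
theorem exists_isUncountableFanPoint_of_isTopPoint {F : Set X} {e : X}
    (h : F ≃ₜ OnePointDiscrete (Cardinal.aleph.{0} 1)) (he : IsTopPoint F e) :
    ∃ heF : e ∈ F, IsUncountableFanPoint F ⟨e, heF⟩ := by
  let D := DiscreteOfCard (Cardinal.aleph.{0} 1)
  have : DiscreteTopology D := ⟨rfl⟩
  have hD : ¬ Countable D := by
    have h1 : Cardinal.mk D = Cardinal.aleph.{0} 1 := Cardinal.mk_out _
    rw [← Cardinal.mk_le_aleph0_iff, h1, not_le]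
    simp
  let e₀ : F := h.symm OnePoint.infty
  have hiso : ∀ y : F, y ≠ e₀ → IsOpen {y} := by
    intro y hy
    rw [← h.isOpen_image, Set.image_singleton]
    have hne : h y ≠ OnePoint.infty := fun h' => hy (by rw [← h.symm_apply_apply y, h'])
    obtain ⟨d, hd⟩ := OnePoint.ne_infty_iff_exists.1 hne
    rw [← hd, ← Set.image_singleton]
    exact OnePoint.isOpenEmbedding_coe.isOpenMap _ (isOpen_discrete _)
  have hunc : ∀ V : Set F, IsOpen V → e₀ ∈ V → ¬ V.Countable := by
    intro V hV heV hVc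
    have hV' : IsOpen (h '' V) := h.isOpen_image.2 hV
    have h1 : OnePoint.infty ∈ h '' V := ⟨e₀, heV, h.apply_symm_apply _⟩
    have h2 := ((OnePoint.isOpen_iff_of_mem h1).1 hV').2.finite_of_discrete
    have h3 : ((↑) ⁻¹' (h '' V) : Set D).Countable :=
      (hVc.image h).preimage_of_injOn OnePoint.coe_injective.injOn
    refine hD (Set.countable_univ_iff.1 ((h3.union h2.countable).mono fun d _ => ?_))
    exact Classical.em _
  have hfan : IsUncountableFanPoint F e₀ :=
    ⟨⟨Set.univ, isOpen_univ, trivial, fun y _ => hiso y⟩, hunc⟩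
  have hacc : (e₀ : X) ∈ derivedSet F := by
    rw [mem_derivedSet, accPt_iff_nhds]
    intro U hU
    by_contra! hcon
    obtain ⟨O, hOU, hO, heO⟩ := mem_nhds_iff.1 hU
    refine hunc (Subtype.val ⁻¹' O) (hO.preimage continuous_subtype_val) heO
      ((Set.countable_singleton e₀).mono fun y hy => ?_)
    exact Subtype.ext (hcon y ⟨hOU hy, y.2⟩)
  have hnacc : ∀ y ∈ F, y ∈ derivedSet F → y = e₀ := by
    intro y hy hyacc
    by_contra hne
    have h1 := hiso ⟨y, hy⟩ fun h => hne (congrArg Subtype.val h)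
    obtain ⟨O, hO, hOy⟩ := isOpen_induced_iff.1 h1
    have hyO : (⟨y, hy⟩ : F) ∈ Subtype.val ⁻¹' O := hOy ▸ rfl
    obtain ⟨z, ⟨hzO, hzF⟩, hzy⟩ := accPt_iff_nhds.1 hyacc O (hO.mem_nhds hyO)
    have h2 : (⟨z, hzF⟩ : F) ∈ ({⟨y, hy⟩} : Set F) := hOy ▸ hzO
    exact hzy (congrArg Subtype.val h2)
  have hone : iteratedDerivedSet F (0 + 1) = {(e₀ : X)} := by
    rw [iteratedDerivedSet_succ, iteratedDerivedSet_zero]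
    ext y
    constructor
    · rintro ⟨hy, hyF⟩
      exact hnacc y hyF hy
    · rintro rfl
      exact ⟨hacc, e₀.2⟩
  have hFinf : F.Infinite := fun hf => hunc Set.univ isOpen_univ trivial
    (Set.countable_univ_iff.2 hf.countable.to_subtype)
  have hrank : rank F = 1 := by
    have hmem : (1 : Ordinal.{u}) ∈ {α : Ordinal.{u} | (iteratedDerivedSet F α).Finite ∨
        Preperfect (iteratedDerivedSet F α)} := by
      left
      rw [zero_add] at hone
      rw [hone]
      exact Set.finite_singleton _
    refine le_antisymm (csInf_le' hmem) ?_
    rw [Order.one_le_iff_pos, pos_iff_ne_zero]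
    intro h0
    have h1 := csInf_mem (s := {α : Ordinal.{u} | (iteratedDerivedSet F α).Finite ∨
        Preperfect (iteratedDerivedSet F α)}) ⟨1, hmem⟩
    rw [show sInf _ = (0 : Ordinal.{u}) from h0] at h1
    simp only [Set.mem_ofPred_eq, iteratedDerivedSet_zero] at h1
    rcases h1 with h1 | h1
    · exact hFinf h1
    · obtain ⟨y, hyF, hy⟩ := hFinf.exists_notMem_finite (Set.finite_singleton (e₀ : X))
      exact hy (hnacc y hyF (preperfect_iff_subset_derivedSet.1 h1 hyF))
  have hee : e = e₀ := by
    unfold IsTopPoint at he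
    rw [hrank, ← zero_add (1 : Ordinal.{u}), hone] at he
    exact (Set.singleton_injective he).symm
  subst hee
  exact ⟨e₀.2, hfan⟩

end Fan

theorem finite_setOf_isTopPoint {X : Type u} [TopologicalSpace X] (hscat : IsScatteredSpace X)
    (himage : IsContinuousImageOfCompactIntervalSpace.{u, v} X) (hCO : IsCOSpace X) :
    {e : X | ∃ F : Set X, Nonempty (F ≃ₜ OnePointDiscrete (Cardinal.aleph.{0} 1)) ∧
      IsTopPoint F e}.Finite := by
  have := hscat.hausdorff
  refine (isShrinkablePair_fanPoint.finite_setOf_exists_isClosed hscat himage hCO).subset ?_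
  rintro e ⟨F, ⟨h⟩, he⟩
  have : CompactSpace F := h.symm.compactSpace
  exact ⟨F, (isCompact_iff_compactSpace.2 this).isClosed,
    exists_isUncountableFanPoint_of_isTopPoint h he⟩

open Cardinal Filter

/-! ### Branches at a point -/

section Unibranch

/-- The closed set `L` accumulates at `x`, and it does so along a single branch: any two closed
subsets of `L` accumulating at `x` have a common point other than `x`. -/
structure IsUnibranch (X : Type u) [TopologicalSpace X] (L : Set X) (x : X) : Prop where
  isClosed : IsClosed L
  accPt : AccPt x (𝓟 L)
  exists_ne : ∀ A B : Set X, IsClosed A → IsClosed B → A ⊆ L → B ⊆ L → AccPt x (𝓟 A) →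
    AccPt x (𝓟 B) → ∃ y ∈ A ∩ B, y ≠ x

/-- Every neighbourhood of `x` has at least `m` points in common with `L`. -/
def IsLargeAt (m : Cardinal.{u}) (X : Type u) [TopologicalSpace X] (L : Set X) (x : X) : Prop :=
  ∀ O : Set X, IsOpen O → x ∈ O → m ≤ #(O ∩ L : Set X)

/-- All points near `x`, except `x` itself, have neighbourhoods with fewer than `m` points. -/
def IsSmallAround (m : Cardinal.{u}) (X : Type u) [TopologicalSpace X] (x : X) : Prop :=
  ∃ V : Set X, IsOpen V ∧ x ∈ V ∧ ∀ y ∈ V, y ≠ x → ∃ O : Set X, IsOpen O ∧ y ∈ O ∧ #O < m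

/-- Two branches, one of which is `m`-large, meet at the point `x` only. -/
structure AreBranchesAt (m : Cardinal.{u}) (X : Type u) [TopologicalSpace X] (L₁ L₂ : Set X)
    (x : X) : Prop where
  left : IsUnibranch X L₁ x
  right : IsUnibranch X L₂ x
  inter : L₁ ∩ L₂ = {x}
  large : IsLargeAt m X L₁ x

/-- At least two branches of the space emanate from the point. -/
def IsMultibranchPoint (m : Cardinal.{u}) : PointProperty.{u} := fun X _ x =>
  (∃ L₁ L₂ : Set X, AreBranchesAt m X L₁ L₂ x) ∧ IsSmallAround m X x

/-- Exactly two branches of the space emanate from the point. -/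
def IsTwoBranchPoint (m : Cardinal.{u}) : PointProperty.{u} := fun X _ x =>
  (∃ L₁ L₂ : Set X, AreBranchesAt m X L₁ L₂ x ∧ L₁ ∪ L₂ ∈ 𝓝 x) ∧ IsSmallAround m X x

/-- Exactly one branch of the space emanates from the point. -/
def IsOneBranchPoint (m : Cardinal.{u}) : PointProperty.{u} := fun X _ x =>
  (∃ L ∈ 𝓝 x, IsUnibranch X L x ∧ IsLargeAt m X L x) ∧ IsSmallAround m X x

variable {X Z : Type u} [TopologicalSpace X] [TopologicalSpace Z] {m : Cardinal.{u}}

theorem IsUnibranch.image {i : Z → X} (hi : IsClosedEmbedding i) {L : Set Z} {z : Z}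
    (h : IsUnibranch Z L z) : IsUnibranch X (i '' L) (i z) where
  isClosed := hi.isClosedMap L h.isClosed
  accPt := hi.isEmbedding.accPt_image_iff.2 h.accPt
  exists_ne := by
    intro A B hA hB hAL hBL hzA hzB
    have hA' : i '' (i ⁻¹' A) = A :=
      Set.image_preimage_eq_of_subset (hAL.trans (Set.image_subset_range i L))
    have hB' : i '' (i ⁻¹' B) = B :=
      Set.image_preimage_eq_of_subset (hBL.trans (Set.image_subset_range i L))
    rw [← hA', hi.isEmbedding.accPt_image_iff] at hzA
    rw [← hB', hi.isEmbedding.accPt_image_iff] at hzB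
    have hsub : ∀ C : Set X, C ⊆ i '' L → i ⁻¹' C ⊆ L := fun C hC => by
      rw [← Set.preimage_image_eq L hi.injective]
      exact Set.preimage_mono hC
    obtain ⟨y, hy, hyz⟩ := h.exists_ne _ _ (hA.preimage hi.continuous) (hB.preimage hi.continuous)
      (hsub A hAL) (hsub B hBL) hzA hzB
    exact ⟨i y, hy, fun h => hyz (hi.injective h)⟩

theorem IsUnibranch.preimage {i : Z → X} (hi : IsClosedEmbedding i) {L : Set X} {z : Z}
    (h : IsUnibranch X L (i z)) (hL : L ⊆ Set.range i) : IsUnibranch Z (i ⁻¹' L) z where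
  isClosed := h.isClosed.preimage hi.continuous
  accPt := by
    rw [← hi.isEmbedding.accPt_image_iff, Set.image_preimage_eq_of_subset hL]
    exact h.accPt
  exists_ne := by
    intro A B hA hB hAL hBL hzA hzB
    obtain ⟨_, ⟨⟨y, hy, rfl⟩, hy'⟩, hyz⟩ := h.exists_ne _ _ (hi.isClosedMap A hA)
      (hi.isClosedMap B hB) (Set.image_subset_iff.2 hAL) (Set.image_subset_iff.2 hBL)
      (hi.isEmbedding.accPt_image_iff.2 hzA) (hi.isEmbedding.accPt_image_iff.2 hzB)
    exact ⟨y, ⟨hy, (hi.injective.mem_set_image).1 hy'⟩, fun h => hyz (h ▸ rfl)⟩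

theorem IsUnibranch.inter_nhds {L U : Set X} {x : X} (h : IsUnibranch X L x) (hU : IsClosed U)
    (hxU : U ∈ 𝓝 x) : IsUnibranch X (L ∩ U) x where
  isClosed := h.isClosed.inter hU
  accPt := by
    rw [Set.inter_comm]
    exact h.accPt.nhds_inter hxU
  exists_ne A B hA hB hAL hBL hxA hxB := h.exists_ne A B hA hB
    (hAL.trans Set.inter_subset_left) (hBL.trans Set.inter_subset_left) hxA hxB

theorem IsLargeAt.image {i : Z → X} (hi : Continuous i) (hinj : Function.Injective i) {L : Set Z}
    {z : Z} (h : IsLargeAt m Z L z) : IsLargeAt m X (i '' L) (i z) := by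
  intro O hO hz
  refine (h _ (hO.preimage hi) hz).trans ?_
  rw [← Cardinal.mk_image_eq hinj, Set.image_preimage_inter]

theorem IsLargeAt.preimage {i : Z → X} (hi : IsEmbedding i) {L : Set X} {z : Z}
    (h : IsLargeAt m X L (i z)) (hL : L ⊆ Set.range i) : IsLargeAt m Z (i ⁻¹' L) z := by
  intro O hO hz
  obtain ⟨O', hO', rfl⟩ := hi.isOpen_iff.1 hO
  refine (h O' hO' hz).trans ?_
  rw [← Set.preimage_inter, ← Cardinal.mk_image_eq hi.injective,
    Set.image_preimage_eq_of_subset (Set.inter_subset_right.trans hL)]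

theorem IsLargeAt.inter_nhds {L U : Set X} {x : X} (h : IsLargeAt m X L x) (hU : U ∈ 𝓝 x) :
    IsLargeAt m X (L ∩ U) x := by
  intro O hO hx
  refine (h (O ∩ interior U) (hO.inter isOpen_interior)
    ⟨hx, mem_interior_iff_mem_nhds.2 hU⟩).trans (Cardinal.mk_le_mk_of_subset ?_)
  rintro y ⟨⟨hyO, hyU⟩, hyL⟩
  exact ⟨hyO, hyL, interior_subset hyU⟩

theorem IsSmallAround.image {i : Z → X} (hi : IsOpenEmbedding i) {z : Z}
    (h : IsSmallAround m Z z) : IsSmallAround m X (i z) := by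
  obtain ⟨V, hV, hz, h⟩ := h
  refine ⟨i '' V, hi.isOpenMap V hV, Set.mem_image_of_mem i hz, ?_⟩
  rintro _ ⟨y, hy, rfl⟩ hyz
  obtain ⟨O, hO, hyO, hOm⟩ := h y hy fun h => hyz (h ▸ rfl)
  exact ⟨i '' O, hi.isOpenMap O hO, Set.mem_image_of_mem i hyO,
    by rwa [Cardinal.mk_image_eq hi.injective]⟩

theorem IsSmallAround.preimage {i : Z → X} (hi : Continuous i) (hinj : Function.Injective i) {z : Z}
    (h : IsSmallAround m X (i z)) : IsSmallAround m Z z := by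
  obtain ⟨V, hV, hz, h⟩ := h
  refine ⟨i ⁻¹' V, hV.preimage hi, hz, fun y hy hyz => ?_⟩
  obtain ⟨O, hO, hyO, hOm⟩ := h (i y) hy fun h => hyz (hinj h)
  exact ⟨i ⁻¹' O, hO.preimage hi, hyO,
    (Cardinal.mk_preimage_of_injective i O hinj).trans_lt hOm⟩

theorem AreBranchesAt.image {i : Z → X} (hi : IsClosedEmbedding i) {L₁ L₂ : Set Z} {z : Z}
    (h : AreBranchesAt m Z L₁ L₂ z) : AreBranchesAt m X (i '' L₁) (i '' L₂) (i z) where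
  left := h.left.image hi
  right := h.right.image hi
  inter := by rw [← Set.image_inter hi.injective, h.inter, Set.image_singleton]
  large := h.large.image hi.continuous hi.injective

theorem AreBranchesAt.preimage {i : Z → X} (hi : IsClosedEmbedding i) {L₁ L₂ : Set X} {z : Z}
    (h : AreBranchesAt m X L₁ L₂ (i z)) (h₁ : L₁ ⊆ Set.range i) (h₂ : L₂ ⊆ Set.range i) :
    AreBranchesAt m Z (i ⁻¹' L₁) (i ⁻¹' L₂) z where
  left := h.left.preimage hi h₁
  right := h.right.preimage hi h₂
  inter := by
    rw [← Set.preimage_inter, h.inter, ← Set.image_singleton,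
      Set.preimage_image_eq _ hi.injective]
  large := h.large.preimage hi.isEmbedding h₁

theorem AreBranchesAt.inter_nhds {L₁ L₂ U : Set X} {x : X} (h : AreBranchesAt m X L₁ L₂ x)
    (hU : IsClosed U) (hxU : U ∈ 𝓝 x) : AreBranchesAt m X (L₁ ∩ U) (L₂ ∩ U) x where
  left := h.left.inter_nhds hU hxU
  right := h.right.inter_nhds hU hxU
  inter := by
    rw [← Set.inter_inter_distrib_right, h.inter, Set.inter_eq_left]
    exact Set.singleton_subset_iff.2 (mem_of_mem_nhds hxU)
  large := h.large.inter_nhds hxU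

theorem range_mem_nhds {i : Z → X} (hi : IsOpenEmbedding i) (z : Z) : Set.range i ∈ 𝓝 (i z) :=
  hi.isOpen_range.mem_nhds (Set.mem_range_self z)

theorem isLocal_isMultibranchPoint : (IsMultibranchPoint m).IsLocal where
  iff := by
    intro X Z _ _ i hio hic z
    refine and_congr ⟨?_, ?_⟩ ⟨fun h => h.preimage hio.continuous hio.injective,
      fun h => h.image hio⟩
    · rintro ⟨L₁, L₂, h⟩
      exact ⟨_, _, (h.inter_nhds hic.isClosed_range (range_mem_nhds hio z)).preimage hic
        Set.inter_subset_right Set.inter_subset_right⟩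
    · rintro ⟨L₁, L₂, h⟩
      exact ⟨_, _, h.image hic⟩

theorem isLocal_isTwoBranchPoint : (IsTwoBranchPoint m).IsLocal where
  iff := by
    intro X Z _ _ i hio hic z
    refine and_congr ⟨?_, ?_⟩ ⟨fun h => h.preimage hio.continuous hio.injective,
      fun h => h.image hio⟩
    · rintro ⟨L₁, L₂, h, hL⟩
      refine ⟨_, _, (h.inter_nhds hic.isClosed_range (range_mem_nhds hio z)).preimage hic
        Set.inter_subset_right Set.inter_subset_right, ?_⟩
      rw [← Set.preimage_union, ← Set.union_inter_distrib_right]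
      exact hio.continuous.continuousAt.preimage_mem_nhds
        (Filter.inter_mem hL (range_mem_nhds hio z))
    · rintro ⟨L₁, L₂, h, hL⟩
      refine ⟨_, _, h.image hic, ?_⟩
      rw [← Set.image_union]
      exact hio.image_mem_nhds.2 hL

theorem isLocal_isOneBranchPoint : (IsOneBranchPoint m).IsLocal where
  iff := by
    intro X Z _ _ i hio hic z
    refine and_congr ⟨?_, ?_⟩ ⟨fun h => h.preimage hio.continuous hio.injective,
      fun h => h.image hio⟩
    · rintro ⟨L, hL, h, hm⟩
      exact ⟨i ⁻¹' (L ∩ Set.range i), hio.continuous.continuousAt.preimage_mem_nhds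
          (Filter.inter_mem hL (range_mem_nhds hio z)),
        (h.inter_nhds hic.isClosed_range (range_mem_nhds hio z)).preimage hic
          Set.inter_subset_right,
        (hm.inter_nhds (range_mem_nhds hio z)).preimage hic.isEmbedding Set.inter_subset_right⟩
    · rintro ⟨L, hL, h, hm⟩
      exact ⟨i '' L, hio.image_mem_nhds.2 hL, h.image hic, hm.image hic.continuous hic.injective⟩

/-- This isolates branch points from one another: each carries an `m`-large branch, which its
neighbours are too small to have. -/
theorem IsSmallAround.exists_not_isLargeAt {x : X} (h : IsSmallAround m X x) :
    ∃ V : Set X, IsOpen V ∧ x ∈ V ∧ ∀ y ∈ V, y ≠ x → ∀ L, ¬ IsLargeAt m X L y := by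
  obtain ⟨V, hV, hx, h⟩ := h
  refine ⟨V, hV, hx, fun y hy hyx L hL => ?_⟩
  obtain ⟨O, hO, hyO, hOm⟩ := h y hy hyx
  exact absurd ((hL O hO hyO).trans (Cardinal.mk_le_mk_of_subset Set.inter_subset_left))
    (not_le.2 hOm)

/-- Inside a single branch that is a neighbourhood of `x`, the traces of `L₁` and `L₂` would have to
meet away from `x`. -/
theorem IsMultibranchPoint.not_isOneBranchPoint {x : X} (h : IsMultibranchPoint m X x) :
    ¬ IsOneBranchPoint m X x := by
  obtain ⟨⟨L₁, L₂, hL⟩, -⟩ := h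
  rintro ⟨⟨L, hLx, h, -⟩, -⟩
  obtain ⟨y, hy, hyx⟩ := h.exists_ne (L ∩ L₁) (L ∩ L₂) (h.isClosed.inter hL.left.isClosed)
    (h.isClosed.inter hL.right.isClosed) Set.inter_subset_left Set.inter_subset_left
    (hL.left.accPt.nhds_inter hLx) (hL.right.accPt.nhds_inter hLx)
  have : y ∈ L₁ ∩ L₂ := ⟨hy.1.2, hy.2.2⟩
  rw [hL.inter] at this
  exact hyx this

theorem AreBranchesAt.mem {L₁ L₂ : Set X} {x : X} (h : AreBranchesAt m X L₁ L₂ x) :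
    x ∈ L₁ ∧ x ∈ L₂ :=
  (h.inter.symm ▸ Set.mem_singleton x : x ∈ L₁ ∩ L₂)

/-- Restrict to `L₁`, the branch known to be large; smallness of the neighbours is inherited by
subspaces. -/
theorem isMultibranchPoint_shrinksTo_isOneBranchPoint :
    (IsMultibranchPoint m).ShrinksTo (IsOneBranchPoint m) := by
  rintro X _ _ _ x ⟨⟨L₁, L₂, hL⟩, hs⟩
  have hi := hL.left.isClosed.isClosedEmbedding_subtypeVal
  have hr : L₁ ⊆ Set.range (Subtype.val : L₁ → X) := by rw [Subtype.range_coe]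
  refine ⟨L₁, hL.left.isClosed, hL.mem.1, ⟨Subtype.val ⁻¹' L₁, ?_,
    IsUnibranch.preimage (z := (⟨x, hL.mem.1⟩ : L₁)) hi hL.left hr,
    IsLargeAt.preimage (z := (⟨x, hL.mem.1⟩ : L₁)) hi.isEmbedding hL.large hr⟩,
    IsSmallAround.preimage (z := (⟨x, hL.mem.1⟩ : L₁)) hi.continuous hi.injective hs⟩
  exact Filter.univ_mem' fun y => y.2

theorem isMultibranchPoint_shrinksTo_isTwoBranchPoint :
    (IsMultibranchPoint m).ShrinksTo (IsTwoBranchPoint m) := by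
  rintro X _ _ _ x ⟨⟨L₁, L₂, hL⟩, hs⟩
  have hcl : IsClosed (L₁ ∪ L₂) := hL.left.isClosed.union hL.right.isClosed
  have hi := hcl.isClosedEmbedding_subtypeVal
  have hx : x ∈ L₁ ∪ L₂ := Or.inl hL.mem.1
  have hr : L₁ ∪ L₂ ⊆ Set.range (Subtype.val : (L₁ ∪ L₂ : Set X) → X) := by
    rw [Subtype.range_coe]
  refine ⟨L₁ ∪ L₂, hcl, hx, ⟨_, _, AreBranchesAt.preimage (z := (⟨x, hx⟩ : (L₁ ∪ L₂ : Set X))) hi hL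
    (Set.subset_union_left.trans hr) (Set.subset_union_right.trans hr), ?_⟩,
    IsSmallAround.preimage (z := (⟨x, hx⟩ : (L₁ ∪ L₂ : Set X))) hi.continuous hi.injective hs⟩
  exact Filter.univ_mem' fun y => y.2

theorem isShrinkablePair_branchPoint :
    IsShrinkablePair (IsMultibranchPoint m) (IsOneBranchPoint m) where
  left_local := isLocal_isMultibranchPoint
  right_local := isLocal_isOneBranchPoint
  isolated := by
    intro X _ x hx
    obtain ⟨V, hV, hxV, h⟩ := (hx.elim (fun h => h.2) fun h => h.2).exists_not_isLargeAt
    refine ⟨V, hV, hxV, fun y hy hyx => ⟨?_, ?_⟩⟩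
    · rintro ⟨⟨L₁, L₂, hL⟩, -⟩
      exact h y hy hyx L₁ hL.large
    · rintro ⟨⟨L, -, -, hL⟩, -⟩
      exact h y hy hyx L hL
  not_both := fun h => h.not_isOneBranchPoint
  shrinksTo := isMultibranchPoint_shrinksTo_isOneBranchPoint

/-- Three closed sets meeting in `x` only cannot all accumulate at a point `x` from which exactly
two branches emanate. -/
theorem IsTwoBranchPoint.false_of_three {x : X} (h : IsTwoBranchPoint m X x) {L : Fin 3 → Set X}
    (hcl : ∀ i, IsClosed (L i)) (hacc : ∀ i, AccPt x (𝓟 (L i)))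
    (hL : ∀ i j, i ≠ j → L i ∩ L j ⊆ {x}) : False := by
  obtain ⟨⟨M₁, M₂, hM, hnhds⟩, -⟩ := h
  have hbr : ∀ b : Bool, IsUnibranch X (bif b then M₁ else M₂) x := by
    rintro (_ | _)
    · exact hM.right
    · exact hM.left
  have hex : ∀ i, ∃ b : Bool, AccPt x (𝓟 ((bif b then M₁ else M₂) ∩ L i)) := by
    intro i
    have h1 := (hacc i).nhds_inter hnhds
    rw [Set.union_inter_distrib_right, ← mem_derivedSet, derivedSet_union] at h1
    rcases h1 with h1 | h1
    · exact ⟨true, h1⟩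
    · exact ⟨false, h1⟩
  choose b hb using hex
  -- Pigeonhole: two of the three sets accumulate along the same branch and so meet away from `x`.
  obtain ⟨i, j, hij, hbij⟩ := Fintype.exists_ne_map_eq_of_card_lt b (by simp)
  have hbj := hb j
  rw [← hbij] at hbj
  obtain ⟨y, hy, hyx⟩ := (hbr (b i)).exists_ne _ _ ((hbr (b i)).isClosed.inter (hcl i))
    ((hbr (b i)).isClosed.inter (hcl j)) Set.inter_subset_left Set.inter_subset_left (hb i) hbj
  exact hyx (hL i j hij ⟨hy.1.2, hy.2.2⟩)

end Unibranch

open Cardinal Filter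

/-! ### Ordinal legs -/

section Leg

variable {c : Cardinal.{w}}

instance : CompactSpace (CardSucc c) := by
  rw [← isCompact_iff_compactSpace, ← Set.Icc_bot]
  exact isCompact_Icc

theorem CardSucc.le_last (a : CardSucc c) : a ≤ CardSucc.last c := a.2

theorem CardSucc.isSuccLimit_ord (hc : ℵ₀ ≤ c) : Order.IsSuccLimit c.ord :=
  Cardinal.isSuccLimit_ord hc

theorem CardSucc.exists_between_last (hc : ℵ₀ ≤ c) {a : CardSucc c} (ha : a < CardSucc.last c) :
    ∃ b, a < b ∧ b < CardSucc.last c := by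
  have h1 : Order.succ (a : Ordinal) < c.ord := (isSuccLimit_ord hc).succ_lt ha
  exact ⟨⟨Order.succ (a : Ordinal), h1.le⟩, Order.lt_succ (a : Ordinal), h1⟩

theorem CardSucc.exists_lt_last (hc : ℵ₀ ≤ c) : ∃ a, a < CardSucc.last c :=
  ⟨⟨0, Set.mem_Iic.2 zero_le⟩, (isSuccLimit_ord hc).bot_lt⟩

theorem CardSucc.accPt_last (hc : ℵ₀ ≤ c) : AccPt (CardSucc.last c) (𝓟 Set.univ) := by
  rw [accPt_iff_nhds]
  intro U hU
  obtain ⟨l, hl, hlU⟩ := exists_Ioc_subset_of_mem_nhds hU (exists_lt_last hc)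
  obtain ⟨b, hlb, hb⟩ := exists_between_last hc hl
  exact ⟨b, ⟨hlU ⟨hlb, hb.le⟩, trivial⟩, hb.ne⟩

theorem CardSucc.mk_Iic_lt (hc : ℵ₀ ≤ c) {a : CardSucc c} (ha : a < CardSucc.last c) :
    #(Set.Iic a) < Cardinal.lift.{w + 1} c := by
  have h1 : Order.succ (a : Ordinal) < c.ord := (isSuccLimit_ord hc).succ_lt ha
  rw [← Cardinal.mk_image_eq (Subtype.val_injective)]
  have h2 : (Subtype.val '' Set.Iic a : Set Ordinal.{w}) ⊆ Set.Iio (Order.succ (a : Ordinal)) := by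
    rintro _ ⟨b, hb, rfl⟩
    exact Order.lt_succ_iff.2 (Subtype.coe_le_coe.2 (show b ≤ a from hb))
  refine (Cardinal.mk_le_mk_of_subset h2).trans_lt ?_
  rw [Cardinal.mk_Iio_ordinal, Cardinal.lift_lt]
  exact Cardinal.lt_ord.1 h1

theorem CardSucc.mk_eq (hc : ℵ₀ ≤ c) : #(CardSucc c) = Cardinal.lift.{w + 1} c := by
  have h1 : (Set.Iic c.ord : Set Ordinal.{w}) = Set.Iio (c.ord + 1) := by
    ext; simp
  rw [CardSucc, h1, Cardinal.mk_Iio_ordinal, Ordinal.card_add_one, Cardinal.card_ord,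
    Cardinal.add_one_eq hc]

/-- `O` contains a final segment, whose complement has fewer than `c` points. -/
theorem CardSucc.le_mk_of_isOpen (hc : ℵ₀ ≤ c) {O : Set (CardSucc c)} (hO : IsOpen O)
    (hl : CardSucc.last c ∈ O) : Cardinal.lift.{w + 1} c ≤ #O := by
  obtain ⟨a, ha, haO⟩ := exists_Ioc_subset_of_mem_nhds (hO.mem_nhds hl) (exists_lt_last hc)
  by_contra! hlt
  have h1 : (Set.univ : Set (CardSucc c)) ⊆ Set.Iic a ∪ O := fun b _ =>
    (le_or_gt b a).elim Or.inl fun h => Or.inr (haO ⟨h, le_last b⟩)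
  have h2 : #(CardSucc c) ≤ #(Set.Iic a) + #O := by
    rw [← Cardinal.mk_univ]
    exact (Cardinal.mk_le_mk_of_subset h1).trans (Cardinal.mk_union_le _ _)
  rw [mk_eq hc] at h2
  exact absurd h2 (not_le.2 (Cardinal.add_lt_of_lt (by simpa using hc) (mk_Iic_lt hc ha) hlt))

/-- Without the last point, `A` and `B` are clubs in an ordinal of uncountable cofinality, so they
meet. This is where legality of the triple is needed. -/
theorem CardSucc.exists_mem_inter (hc : c.IsRegular) (hc' : ℵ₀ < c) {A B : Set (CardSucc c)}
    (hA : IsClosed A) (hB : IsClosed B) (hA' : AccPt (CardSucc.last c) (𝓟 A))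
    (hB' : AccPt (CardSucc.last c) (𝓟 B)) : ∃ a ∈ A ∩ B, a ≠ CardSucc.last c := by
  let ι : Set.Iio c.ord → CardSucc c := fun a => ⟨a, Set.mem_Iic.2 (le_of_lt a.2)⟩
  have hι : Continuous ι := continuous_subtype_val.subtype_mk _
  have hclub : ∀ A : Set (CardSucc c), IsClosed A → AccPt (CardSucc.last c) (𝓟 A) →
      IsClub (ι ⁻¹' A) := by
    intro A hA hA'
    refine ⟨fun d hd hne _ a ha => ?_, fun a => ?_⟩
    · exact (closure_minimal hd (hA.preimage hι)) (ha.mem_closure hne)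
    · have h1 : ι a < CardSucc.last c := a.2
      obtain ⟨y, ⟨hay, hyA⟩, hy⟩ := accPt_iff_nhds.1 hA' _ (Ioi_mem_nhds h1)
      have hyl : y < CardSucc.last c := lt_of_le_of_ne (le_last y) hy
      exact ⟨⟨y, hyl⟩, hyA, le_of_lt (show (a : Ordinal) < y from hay)⟩
  have hcof : Order.cof (Set.Iio c.ord) ≠ ℵ₀ := by
    rw [Ordinal.cof_Iio, ← Ordinal.lift_cof, hc.cof_ord]
    intro h
    rw [← Cardinal.lift_aleph0.{w + 1, w}] at h
    exact hc'.ne' (Cardinal.lift_injective h)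
  have : Nonempty (Set.Iio c.ord) := ⟨⟨0, (isSuccLimit_ord hc.aleph0_le).bot_lt⟩⟩
  obtain ⟨a, ha⟩ := ((hclub A hA hA').inter hcof (hclub B hB hB')).nonempty
  exact ⟨ι a, ha, ne_of_lt (show ι a < CardSucc.last c from a.2)⟩

variable {X : Type u} [TopologicalSpace X]

/-- The set `L` is a homeomorphic copy of `c + 1` with last point `x`. -/
def IsLeg (c : Cardinal.{w}) (L : Set X) (x : X) : Prop :=
  ∃ g : CardSucc c → X, IsClosedEmbedding g ∧ g (CardSucc.last c) = x ∧ Set.range g = L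

theorem IsLeg.isClosed {L : Set X} {x : X} (h : IsLeg c L x) : IsClosed L := by
  obtain ⟨g, hg, -, rfl⟩ := h
  exact hg.isClosed_range

theorem IsLeg.accPt {L : Set X} {x : X} (h : IsLeg c L x) (hc : ℵ₀ ≤ c) : AccPt x (𝓟 L) := by
  obtain ⟨g, hg, rfl, rfl⟩ := h
  rw [← Set.image_univ, hg.isEmbedding.accPt_image_iff]
  exact CardSucc.accPt_last hc

theorem IsLeg.lift_mk {L : Set X} {x : X} (h : IsLeg c L x) (hc : ℵ₀ ≤ c) :
    Cardinal.lift.{w + 1} #L = Cardinal.lift.{u} (Cardinal.lift.{w + 1} c) := by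
  obtain ⟨g, hg, -, rfl⟩ := h
  rw [Cardinal.mk_range_eq_of_injective hg.injective, CardSucc.mk_eq hc]

theorem IsLeg.isUnibranch {L : Set X} {x : X} (h : IsLeg c L x) (hc : c.IsRegular)
    (hc' : ℵ₀ < c) : IsUnibranch X L x where
  isClosed := h.isClosed
  accPt := h.accPt hc'.le
  exists_ne := by
    obtain ⟨g, hg, rfl, rfl⟩ := h
    intro A B hA hB hAL hBL hxA hxB
    rw [← Set.image_preimage_eq_of_subset hAL, hg.isEmbedding.accPt_image_iff] at hxA
    rw [← Set.image_preimage_eq_of_subset hBL, hg.isEmbedding.accPt_image_iff] at hxB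
    obtain ⟨a, ha, hal⟩ := CardSucc.exists_mem_inter hc hc' (hA.preimage hg.continuous)
      (hB.preimage hg.continuous) hxA hxB
    exact ⟨g a, ha, fun h => hal (hg.injective h)⟩

theorem IsLeg.isLargeAt {L : Set X} {x : X} (h : IsLeg c L x) (hc : ℵ₀ ≤ c) :
    IsLargeAt #L X L x := by
  intro O hO hx
  rw [← Cardinal.lift_le.{w + 1}, h.lift_mk hc]
  obtain ⟨g, hg, rfl, rfl⟩ := h
  rw [Set.inter_comm, ← Set.image_preimage_eq_range_inter,
    Cardinal.mk_image_eq_lift _ _ hg.injective, Cardinal.lift_le]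
  exact CardSucc.le_mk_of_isOpen hc (hO.preimage hg.continuous) hx

/-- The points of a leg other than its last point have small neighbourhoods in the union of the
leg with a set meeting it in the last point only. -/
theorem IsLeg.exists_isOpen {L M : Set X} {x : X} (h : IsLeg c L x) (hc : ℵ₀ ≤ c)
    (hM : IsClosed M) (hLM : L ∩ M ⊆ {x}) (hopen : IsOpen (L ∪ M)) {m : Cardinal.{u}}
    (hm : #L ≤ m) {y : X} (hy : y ∈ L) (hyx : y ≠ x) :
    ∃ O : Set X, IsOpen O ∧ y ∈ O ∧ #O < m := by
  suffices h' : ∃ O : Set X, IsOpen O ∧ y ∈ O ∧ #O < #L by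
    obtain ⟨O, hO, hyO, hlt⟩ := h'
    exact ⟨O, hO, hyO, hlt.trans_le hm⟩
  have hmk := h.lift_mk hc
  obtain ⟨g, hg, rfl, rfl⟩ := h
  obtain ⟨a, rfl⟩ := hy
  have ha : a < CardSucc.last c := lt_of_le_of_ne a.le_last fun h => hyx (h ▸ rfl)
  obtain ⟨b, hab, hb⟩ := CardSucc.exists_between_last hc ha
  -- An initial segment of the leg is what remains of the open union once two closed sets are
  -- removed.
  have hO : g '' Set.Iio b = (Set.range g ∪ M) \ (g '' Set.Ici b ∪ M) := by
    ext z
    constructor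
    · rintro ⟨d, hd, rfl⟩
      refine ⟨Or.inl ⟨d, rfl⟩, ?_⟩
      rintro (⟨d', hd', h⟩ | h)
      · exact absurd (hg.injective h ▸ hd' : b ≤ d) (not_le.2 hd)
      · have h1 : g d = g (CardSucc.last c) := hLM ⟨⟨d, rfl⟩, h⟩
        exact absurd (hg.injective h1 ▸ hd : CardSucc.last c < b) (not_lt.2 b.le_last)
    · rintro ⟨⟨d, rfl⟩ | h, h'⟩
      · exact ⟨d, Set.mem_Iio.2 (not_le.1 fun h => h' (Or.inl ⟨d, h, rfl⟩)), rfl⟩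
      · exact (h' (Or.inr h)).elim
  refine ⟨g '' Set.Iio b, ?_, ⟨a, hab, rfl⟩, ?_⟩
  · rw [hO]
    exact hopen.sdiff ((hg.isClosedMap _ isClosed_Ici).union hM)
  · rw [← Cardinal.lift_lt.{u, w + 1}, hmk, Cardinal.mk_image_eq_lift _ _ hg.injective,
      Cardinal.lift_lt]
    exact (Cardinal.mk_le_mk_of_subset Set.Iio_subset_Iic_self).trans_lt (CardSucc.mk_Iic_lt hc hb)

theorem IsLeg.mem {L : Set X} {x : X} (h : IsLeg c L x) : x ∈ L := by
  obtain ⟨g, -, rfl, rfl⟩ := h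
  exact ⟨_, rfl⟩

theorem IsLeg.mk_le_mk {c' : Cardinal.{w}} {L L' : Set X} {x : X} (h : IsLeg c L x)
    (h' : IsLeg c' L' x) (hc : ℵ₀ ≤ c) (hc' : ℵ₀ ≤ c') (hle : c ≤ c') : #L ≤ #L' := by
  rw [← Cardinal.lift_le.{w + 1}, h.lift_mk hc, h'.lift_mk hc', Cardinal.lift_le, Cardinal.lift_le]
  exact hle

/-- In a scattered CO space which is a continuous image of a compact interval space there are no
three legs with a common last point and an open union. -/
theorem IsLeg.false_of_three (hscat : IsScatteredSpace X)
    (himage : IsContinuousImageOfCompactIntervalSpace.{u, v} X) (hCO : IsCOSpace X)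
    {c₁ c₂ c₃ : Cardinal.{w}} (hc₁ : c₁.IsRegular) (hc₂ : c₂.IsRegular) (hc₃ : ℵ₀ ≤ c₃)
    (h₁ : ℵ₀ < c₁) (h₂ : ℵ₀ < c₂) (h₂₁ : c₂ ≤ c₁) (h₃₁ : c₃ ≤ c₁) {L₁ L₂ L₃ : Set X} {x : X}
    (hL₁ : IsLeg c₁ L₁ x) (hL₂ : IsLeg c₂ L₂ x) (hL₃ : IsLeg c₃ L₃ x) (h12 : L₁ ∩ L₂ ⊆ {x})
    (h13 : L₁ ∩ L₃ ⊆ {x}) (h23 : L₂ ∩ L₃ ⊆ {x}) (hopen : IsOpen (L₁ ∪ L₂ ∪ L₃)) : False := by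
  -- The threshold `m` is the size of the longest leg: `L₁` is then large at `x`, while proper
  -- initial segments of all three legs are small.
  have hP : IsMultibranchPoint #L₁ X x := by
    refine ⟨⟨L₁, L₂, hL₁.isUnibranch hc₁ h₁, hL₂.isUnibranch hc₂ h₂,
      Set.Subset.antisymm h12 (Set.singleton_subset_iff.2 ⟨hL₁.mem, hL₂.mem⟩),
      hL₁.isLargeAt h₁.le⟩, L₁ ∪ L₂ ∪ L₃, hopen, Or.inl (Or.inl hL₁.mem), ?_⟩
    rintro y ((hy | hy) | hy) hyx
    · refine hL₁.exists_isOpen h₁.le (hL₂.isClosed.union hL₃.isClosed) ?_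
        (by rwa [← Set.union_assoc]) le_rfl hy hyx
      rw [Set.inter_union_distrib_left]
      exact Set.union_subset h12 h13
    · refine hL₂.exists_isOpen h₂.le (hL₁.isClosed.union hL₃.isClosed) ?_
        (by rwa [← Set.union_assoc, Set.union_comm L₂]) (hL₂.mk_le_mk hL₁ h₂.le h₁.le h₂₁) hy hyx
      rw [Set.inter_union_distrib_left, Set.inter_comm L₂ L₁]
      exact Set.union_subset h12 h23
    · refine hL₃.exists_isOpen hc₃ (hL₁.isClosed.union hL₂.isClosed) ?_
        (by rwa [Set.union_comm]) (hL₃.mk_le_mk hL₁ hc₃ h₁.le h₃₁) hy hyx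
      rw [Set.inter_union_distrib_left, Set.inter_comm L₃, Set.inter_comm L₃]
      exact Set.union_subset h13 h23
  have hR : IsTwoBranchPoint #L₁ X x :=
    isShrinkablePair_branchPoint.of_shrinksTo isLocal_isTwoBranchPoint
      isMultibranchPoint_shrinksTo_isTwoBranchPoint
      (fun _ _ _ h => ⟨h.1.imp fun _ => Exists.imp fun _ => And.left, h.2⟩) hscat himage hCO hP
  refine hR.false_of_three (L := ![L₁, L₂, L₃]) ?_ ?_ ?_
  · intro i
    fin_cases i
    · exact hL₁.isClosed
    · exact hL₂.isClosed
    · exact hL₃.isClosed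
  · intro i
    fin_cases i
    · exact hL₁.accPt h₁.le
    · exact hL₂.accPt h₂.le
    · exact hL₃.accPt hc₃
  · intro i j hij
    fin_cases i <;> fin_cases j <;> first
      | exact absurd rfl hij
      | assumption
      | (rw [Set.inter_comm]; assumption)

end Leg

/-- The copy is compact, hence closed, and the CO property replaces it by a clopen copy, in which
the union of the three legs is open. -/
theorem not_exists_isEmbedding_tripleSpace {X : Type u} [TopologicalSpace X]
    (hscat : IsScatteredSpace X) (himage : IsContinuousImageOfCompactIntervalSpace.{u, v} X)
    (hCO : IsCOSpace X) {κ lam mu : Cardinal.{w}} (h : IsLegalTriple κ lam mu) :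
    ¬ ∃ f : TripleSpace κ lam mu → X, IsEmbedding f := by
  rintro ⟨f, hf⟩
  have := hscat.hausdorff
  have hK : IsClosed (Set.range f) := (isCompact_range hf.continuous).isClosed
  obtain ⟨j, hjo, hjc⟩ := hCO.exists_embedding hK
  let g : TripleSpace κ lam mu → X := fun t => j ⟨f t, t, rfl⟩
  have hgc : Continuous g := hjc.continuous.comp (hf.continuous.subtype_mk _)
  have hginj : Function.Injective g := fun s t hst =>
    hf.injective (Subtype.mk.inj (hjc.injective hst))
  have hgr : Set.range g = Set.range j := by
    ext y
    constructor
    · rintro ⟨t, rfl⟩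
      exact ⟨_, rfl⟩
    · rintro ⟨⟨_, t, rfl⟩, rfl⟩
      exact ⟨t, rfl⟩
  let p : CardSucc κ ⊕ CardSucc lam ⊕ CardSucc mu → X := fun s =>
    g (Quotient.mk (tripleSetoid κ lam mu) s)
  have hpc : Continuous p := hgc.comp continuous_quot_mk
  have hp : ∀ s t, p s = p t ↔ s = t ∨ (s ∈ lastPoints κ lam mu ∧ t ∈ lastPoints κ lam mu) :=
    fun s t => hginj.eq_iff.trans Quotient.eq
  let g₁ : CardSucc κ → X := fun a => p (Sum.inl a)
  let g₂ : CardSucc lam → X := fun a => p (Sum.inr (Sum.inl a))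
  let g₃ : CardSucc mu → X := fun a => p (Sum.inr (Sum.inr a))
  have hg₁ : IsClosedEmbedding g₁ := by
    refine (hpc.comp continuous_inl).isClosedEmbedding fun a b hab => ?_
    have := (hp _ _).1 hab
    simp [lastPoints] at this
    grind
  have hg₂ : IsClosedEmbedding g₂ := by
    refine (hpc.comp (continuous_inr.comp continuous_inl)).isClosedEmbedding fun a b hab => ?_
    have := (hp _ _).1 hab
    simp [lastPoints] at this
    grind
  have hg₃ : IsClosedEmbedding g₃ := by
    refine (hpc.comp (continuous_inr.comp continuous_inr)).isClosedEmbedding fun a b hab => ?_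
    have := (hp _ _).1 hab
    simp [lastPoints] at this
    grind
  set x := g₁ (CardSucc.last κ) with hx
  have hx₂ : g₂ (CardSucc.last lam) = x := (hp _ _).2 (Or.inr (by simp [lastPoints]))
  have hx₃ : g₃ (CardSucc.last mu) = x := (hp _ _).2 (Or.inr (by simp [lastPoints]))
  have h12 : Set.range g₁ ∩ Set.range g₂ ⊆ {x} := by
    rintro _ ⟨⟨a, rfl⟩, b, hab⟩
    have := (hp _ _).1 hab
    simp [lastPoints] at this
    rw [this.2]
    rfl
  have h13 : Set.range g₁ ∩ Set.range g₃ ⊆ {x} := by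
    rintro _ ⟨⟨a, rfl⟩, b, hab⟩
    have := (hp _ _).1 hab
    simp [lastPoints] at this
    rw [this.2]
    rfl
  have h23 : Set.range g₂ ∩ Set.range g₃ ⊆ {x} := by
    rintro _ ⟨⟨a, rfl⟩, b, hab⟩
    have := (hp _ _).1 hab
    simp [lastPoints] at this
    rw [this.2]
    exact hx₂
  have hopen : IsOpen (Set.range g₁ ∪ Set.range g₂ ∪ Set.range g₃) := by
    convert hjo.isOpen_range using 1
    rw [← hgr]
    ext y
    constructor
    · rintro ((⟨a, rfl⟩ | ⟨a, rfl⟩) | ⟨a, rfl⟩) <;> exact ⟨_, rfl⟩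
    · rintro ⟨t, rfl⟩
      induction t using Quotient.inductionOn with
      | h s =>
        rcases s with a | a | a
        · exact Or.inl (Or.inl ⟨a, rfl⟩)
        · exact Or.inl (Or.inr ⟨a, rfl⟩)
        · exact Or.inr ⟨a, rfl⟩
  have hL₁ : IsLeg κ (Set.range g₁) x := ⟨g₁, hg₁, rfl, rfl⟩
  have hL₂ : IsLeg lam (Set.range g₂) x := ⟨g₂, hg₂, hx₂, rfl⟩
  have hL₃ : IsLeg mu (Set.range g₃) x := ⟨g₃, hg₃, hx₃, rfl⟩
  obtain ⟨hκ, hlam, hmu, hlam', hmu'⟩ := h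
  -- A longest leg takes the first place and another uncountable one the second. If `κ` exceeds
  -- `lam` and `mu`, it is itself uncountable; otherwise it goes third and may be countable.
  rcases le_total lam mu with hle | hle
  · rcases le_or_gt κ mu with hle' | hlt
    · exact IsLeg.false_of_three hscat himage hCO hmu hlam hκ.aleph0_le hmu' hlam' hle hle' hL₃ hL₂
        hL₁ (by rwa [Set.inter_comm]) (by rwa [Set.inter_comm]) (by rwa [Set.inter_comm])
        (by convert hopen using 1; ac_rfl)
    · exact IsLeg.false_of_three hscat himage hCO hκ hmu hlam.aleph0_le (hmu'.trans hlt) hmu' hlt.le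
        (hle.trans hlt.le) hL₁ hL₃ hL₂ h13 h12 (by rwa [Set.inter_comm])
        (by convert hopen using 1; ac_rfl)
  · rcases le_or_gt κ lam with hle' | hlt
    · exact IsLeg.false_of_three hscat himage hCO hlam hmu hκ.aleph0_le hlam' hmu' hle hle' hL₂ hL₃
        hL₁ h23 (by rwa [Set.inter_comm]) (by rwa [Set.inter_comm])
        (by convert hopen using 1; ac_rfl)
    · exact IsLeg.false_of_three hscat himage hCO hκ hlam hmu.aleph0_le (hlam'.trans hlt) hlam'
        hlt.le (hle.trans hlt.le) hL₁ hL₂ hL₃ h12 h13 h23 hopen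

end COSpaces

theorem proposition5p1 {X : Type u} [TopologicalSpace X]
    (hscat : COSpaces.IsScatteredSpace X)
    (himage : COSpaces.IsContinuousImageOfCompactIntervalSpace.{u, v} X)
    (hCO : COSpaces.IsCOSpace X) :
    (∀ κ lam mu : Cardinal.{w}, COSpaces.IsLegalTriple κ lam mu →
      ¬ ∃ f : COSpaces.TripleSpace κ lam mu → X, IsEmbedding f) ∧
    {e : X | ∃ F : Set X, Nonempty (F ≃ₜ COSpaces.OnePointDiscrete (Cardinal.aleph.{0} 1)) ∧
      COSpaces.IsTopPoint F e}.Finite :=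
  ⟨fun _ _ _ h => COSpaces.not_exists_isEmbedding_tripleSpace hscat himage hCO h,
    COSpaces.finite_setOf_isTopPoint hscat himage hCO⟩
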